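/- Let $f_1,f_2:\mathbb R^n\times\mathbb R^k\times\mathbb R\to\mathbb R^n$, $L_1,L_2:\mathbb R^n\times\mathbb R^k\times\mathbb R\to\mathbb R$, $g:\mathbb R^n\times\mathbb R\to\mathbb R$ and $\phi:\mathbb R^n\to\mathbb R$ be $C^1$; let $t_0,t_f\in\mathbb R$, $x_0,x_f\in\mathbb R^n$, and let $W\subseteq\mathbb R^n$ be a linear subspace ($W=\{0\}$: prescribed terminal state; $W=\mathbb R^n$: free terminal state). An admissible process $(x,u_1,u_2,\tau)$ consists of a crossing time $\tau\in(t_0,t_f)$, continuous controls $u_1$ on $[t_0,\tau]$ and $u_2$ on $[\tau,t_f]$, and a continuous state $x$ on $[t_0,t_f]$ with $x(t_0)=x_0$, $x(t_f)\in x_f+W$, $\dot x=f_1(x,u_1,t)$ on $[t_0,\tau]$, $\dot x=f_2(x,u_2,t)$ on $[\tau,t_f]$, such that $g(x(t),t)$ is negative for $t_0\le t<\tau$, zero at $t=\tau$, and positive for $\tau<t\le t_f$. Its performance index is $$J=\phi(x(t_f))+\int_{t_0}^{\tau}L_1(x,u_1,t)\,dt+\int_{\tau}^{t_f}L_2(x,u_2,t)\,dt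 .$$ Let $(x,u_1,u_2,\tau)$ minimize (or maximize) $J$ among all admissible processes. Put $m=\frac{\partial g}{\partial x}(x(\tau),\tau)$ (as a column vector) and $\mu=\frac{\partial g}{\partial t}(x(\tau),\tau)$; for the interface $m^{\top}x+\mu t+c=0$ these are the given $m$ and $\mu$, and in general they define the tangent plane of the interface at the switching point if $(m,\mu)\ne0$. Write $f_i,L_i$ without arguments for the values at $(x(\tau),u_i(\tau),\tau)$. Assume that the crossing is transversal: $m^{\top}f_1+\mu\neq0$ and $m^{\top}f_2+\mu\ne 0$. Let $H_i(x,\lambda,u,t)=L_i(x,u,t)+\lambda^{\top}f_i(x,u,t)$. Call $(\lambda_1,\lambda_2,\nu)$, with $\lambda_1:[t_0,\tau]\to\mathbb R^n$, $\lambda_2:[\tau,t_f]\to\mathbb R^n$ and $\nu\in\mathbb R$, a co-state along the process if, with all derivatives of $H_i$ taken along the process, - $\dot\lambda_1=-(\partial H_1/\partial x)^{\top}$ and $\partial H_1/\partial u=0$ on $[t_0,\tau]$; $\dot\lambda_2=-(\partial H_2/\partial x)^{\top}$ and $\partial H_2/\partial u=0$ on $[\tau,t_f]$; - $\lambda_2(t_f)-\nabla\phi(x(t_f))\perp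 W$; - $\lambda_2(\tau)-\lambda_1(\tau)+\nu m=0$, and $H_2-H_1=\nu\mu$ at the crossing. (Equivalently, with time as an additional state with co-state $\lambda_t$: the augmented co-state $(\lambda,\lambda_t)$ jumps by $-\nu(m,\mu)$ and the augmented Hamiltonian $H+\lambda_t$ is continuous.) If $W\neq\mathbb R^n$, assume also that the process is normal: in every co-state along it for the problem with $L_1,L_2,\phi$ replaced by $0$, both $\lambda_1$ and $\lambda_2$ vanish identically. Then $\langle m^{\top}f+\mu\rangle>0$, there exists a co-state along the process, and every co-state satisfies the jump law $$\Delta\lambda=-\frac{(\Delta L+\langle\lambda\rangle^{\top}\Delta f)\,m}{\langle m^{\top}f+\mu\rangle},$$ where $\Delta\lambda=\lambda_2(\tau)-\lambda_1(\tau)$, $\Delta L=L_2-L_1$, $\Delta f=f_2-f_1$, $\langle\lambda\rangle=\tfrac12(\lambda_1(\tau)+\lambda_2(\tau))$ and $\langle m^{\top}f+\mu\rangle=\tfrac12\big((m^{\top}f_1+\mu)+(m^{\top}f_2+\mu)\big)$. -/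

import Mathlib

/-- Data of a two-mode optimal control problem on `[t₀, t_f]`, with state space `ℝⁿ`, control space
`ℝᵏ` and a time-varying switching interface `g(x,t) = 0`: mode 1 is active where `g < 0`, mode 2
where `g > 0`. The terminal state is required to lie in `x_f + W`; so `W = ⊥` is the problem with
prescribed terminal state, and `W = ⊤` is the problem with free terminal state. -/
structure SwitchedProblem (n k : ℕ) where
  /-- dynamics of mode 1 -/
  f₁ : EuclideanSpace ℝ (Fin n) → EuclideanSpace ℝ (Fin k) → ℝ → EuclideanSpace ℝ (Fin n)
  /-- dynamics of mode 2 -/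
  f₂ : EuclideanSpace ℝ (Fin n) → EuclideanSpace ℝ (Fin k) → ℝ → EuclideanSpace ℝ (Fin n)
  /-- stage cost of mode 1 -/
  L₁ : EuclideanSpace ℝ (Fin n) → EuclideanSpace ℝ (Fin k) → ℝ → ℝ
  /-- stage cost of mode 2 -/
  L₂ : EuclideanSpace ℝ (Fin n) → EuclideanSpace ℝ (Fin k) → ℝ → ℝ
  /-- interface function -/
  g : EuclideanSpace ℝ (Fin n) → ℝ → ℝ
  /-- terminal cost -/
  φ : EuclideanSpace ℝ (Fin n) → ℝ
  /-- initial time -/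
  t₀ : ℝ
  /-- final time -/
  t_f : ℝ
  /-- initial state -/
  x₀ : EuclideanSpace ℝ (Fin n)
  /-- a point of the terminal set -/
  x_f : EuclideanSpace ℝ (Fin n)
  /-- direction of the terminal set -/
  W : Submodule ℝ (EuclideanSpace ℝ (Fin n))

namespace SwitchedProblem

/-- All data are continuously differentiable. -/
structure IsSmooth {n k : ℕ} (P : SwitchedProblem n k) : Prop where
  f₁ : ContDiff ℝ 1 (fun q : EuclideanSpace ℝ (Fin n) × EuclideanSpace ℝ (Fin k) × ℝ =>
    P.f₁ q.1 q.2.1 q.2.2)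
  f₂ : ContDiff ℝ 1 (fun q : EuclideanSpace ℝ (Fin n) × EuclideanSpace ℝ (Fin k) × ℝ =>
    P.f₂ q.1 q.2.1 q.2.2)
  L₁ : ContDiff ℝ 1 (fun q : EuclideanSpace ℝ (Fin n) × EuclideanSpace ℝ (Fin k) × ℝ =>
    P.L₁ q.1 q.2.1 q.2.2)
  L₂ : ContDiff ℝ 1 (fun q : EuclideanSpace ℝ (Fin n) × EuclideanSpace ℝ (Fin k) × ℝ =>
    P.L₂ q.1 q.2.1 q.2.2)
  g : ContDiff ℝ 1 (fun q : EuclideanSpace ℝ (Fin n) × ℝ => P.g q.1 q.2)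
  φ : ContDiff ℝ 1 P.φ

/-- `(x, u₁, u₂, τ)` is an admissible process: `x` is continuous, starts at `x₀`, ends in the
terminal set, crosses the interface exactly once, at the time `τ`, from `g < 0` to `g > 0`, and
obeys the dynamics of the active mode, under a control which is `u₁` before and `u₂` after the
crossing, each continuous up to the crossing time. (Continuity of `x` on `[t₀, t_f]` is a
consequence of the two differential equations.) -/
structure IsAdmissible {n k : ℕ} (P : SwitchedProblem n k) (x : ℝ → EuclideanSpace ℝ (Fin n))
    (u₁ u₂ : ℝ → EuclideanSpace ℝ (Fin k)) (τ : ℝ) : Prop where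
  mem_Ioo : τ ∈ Set.Ioo P.t₀ P.t_f
  initial : x P.t₀ = P.x₀
  terminal : x P.t_f - P.x_f ∈ P.W
  continuousOn₁ : ContinuousOn u₁ (Set.Icc P.t₀ τ)
  continuousOn₂ : ContinuousOn u₂ (Set.Icc τ P.t_f)
  dynamics₁ : ∀ t ∈ Set.Icc P.t₀ τ,
    HasDerivWithinAt x (P.f₁ (x t) (u₁ t) t) (Set.Icc P.t₀ τ) t
  dynamics₂ : ∀ t ∈ Set.Icc τ P.t_f,
    HasDerivWithinAt x (P.f₂ (x t) (u₂ t) t) (Set.Icc τ P.t_f) t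
  before : ∀ t ∈ Set.Ico P.t₀ τ, P.g (x t) t < 0
  crossing : P.g (x τ) τ = 0
  after : ∀ t ∈ Set.Ioc τ P.t_f, 0 < P.g (x t) t

/-- The performance index `J`. -/
noncomputable def cost {n k : ℕ} (P : SwitchedProblem n k) (x : ℝ → EuclideanSpace ℝ (Fin n))
    (u₁ u₂ : ℝ → EuclideanSpace ℝ (Fin k)) (τ : ℝ) : ℝ :=
  P.φ (x P.t_f) + (∫ t in P.t₀..τ, P.L₁ (x t) (u₁ t) t) + ∫ t in τ..P.t_f, P.L₂ (x t) (u₂ t) t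

/-- `(x, u₁, u₂, τ)` is an admissible process which minimizes, or maximizes, the performance index
among all admissible processes. -/
def IsOptimal {n k : ℕ} (P : SwitchedProblem n k) (x : ℝ → EuclideanSpace ℝ (Fin n))
    (u₁ u₂ : ℝ → EuclideanSpace ℝ (Fin k)) (τ : ℝ) : Prop :=
  P.IsAdmissible x u₁ u₂ τ ∧
    ((∀ y v₁ v₂ σ, P.IsAdmissible y v₁ v₂ σ → P.cost x u₁ u₂ τ ≤ P.cost y v₁ v₂ σ) ∨
      (∀ y v₁ v₂ σ, P.IsAdmissible y v₁ v₂ σ → P.cost y v₁ v₂ σ ≤ P.cost x u₁ u₂ τ))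

/-- Hamiltonian `H₁ = L₁ + λᵀ f₁` of mode 1. -/
noncomputable def H₁ {n k : ℕ} (P : SwitchedProblem n k) (x p : EuclideanSpace ℝ (Fin n))
    (u : EuclideanSpace ℝ (Fin k)) (t : ℝ) : ℝ :=
  P.L₁ x u t + inner ℝ p (P.f₁ x u t)

/-- Hamiltonian `H₂ = L₂ + λᵀ f₂` of mode 2. -/
noncomputable def H₂ {n k : ℕ} (P : SwitchedProblem n k) (x p : EuclideanSpace ℝ (Fin n))
    (u : EuclideanSpace ℝ (Fin k)) (t : ℝ) : ℝ :=
  P.L₂ x u t + inner ℝ p (P.f₂ x u t)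

/-- `m = ∂g/∂x`, the gradient of the interface function with respect to the state. -/
noncomputable def normal {n k : ℕ} (P : SwitchedProblem n k) (x : EuclideanSpace ℝ (Fin n))
    (t : ℝ) : EuclideanSpace ℝ (Fin n) :=
  gradient (fun y => P.g y t) x

/-- `μ = ∂g/∂t`, the partial derivative of the interface function with respect to time. -/
noncomputable def timeSlope {n k : ℕ} (P : SwitchedProblem n k) (x : EuclideanSpace ℝ (Fin n))
    (t : ℝ) : ℝ :=
  deriv (fun s => P.g x s) t

/-- The crossing is transversal: the rate `mᵀ f + μ` at which `g` changes along the trajectory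
vanishes neither just before nor just after the crossing. -/
def IsTransversal {n k : ℕ} (P : SwitchedProblem n k) (x : ℝ → EuclideanSpace ℝ (Fin n))
    (u₁ u₂ : ℝ → EuclideanSpace ℝ (Fin k)) (τ : ℝ) : Prop :=
  inner ℝ (P.normal (x τ) τ) (P.f₁ (x τ) (u₁ τ) τ) + P.timeSlope (x τ) τ ≠ 0 ∧
    inner ℝ (P.normal (x τ) τ) (P.f₂ (x τ) (u₂ τ) τ) + P.timeSlope (x τ) τ ≠ 0

/-- `p₁` on `[t₀, τ]` and `p₂` on `[τ, t_f]` are the two phases of a co-state along the process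
`(x, u₁, u₂, τ)`, with multiplier `ν` for the interface constraint: the adjoint equations, the
stationarity of the Hamiltonian in the control, the transversality condition at the final time,
and the conditions at the crossing. In the problem with the time as additional state, the latter
say that the augmented co-state `(λ, λ_t)` jumps by `-ν (m, μ)` and that the augmented
Hamiltonian `H + λ_t` is continuous; the second one reads `H₂ - H₁ = ν μ`. -/
structure IsCostate {n k : ℕ} (P : SwitchedProblem n k) (x : ℝ → EuclideanSpace ℝ (Fin n))
    (u₁ u₂ : ℝ → EuclideanSpace ℝ (Fin k)) (τ : ℝ)
    (p₁ p₂ : ℝ → EuclideanSpace ℝ (Fin n)) (ν : ℝ) : Prop where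
  adjoint₁ : ∀ t ∈ Set.Icc P.t₀ τ,
    HasDerivWithinAt p₁ (-gradient (fun y => P.H₁ y (p₁ t) (u₁ t) t) (x t)) (Set.Icc P.t₀ τ) t
  adjoint₂ : ∀ t ∈ Set.Icc τ P.t_f,
    HasDerivWithinAt p₂ (-gradient (fun y => P.H₂ y (p₂ t) (u₂ t) t) (x t)) (Set.Icc τ P.t_f) t
  stationary₁ : ∀ t ∈ Set.Icc P.t₀ τ, gradient (fun v => P.H₁ (x t) (p₁ t) v t) (u₁ t) = 0
  stationary₂ : ∀ t ∈ Set.Icc τ P.t_f, gradient (fun v => P.H₂ (x t) (p₂ t) v t) (u₂ t) = 0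
  terminal : p₂ P.t_f - gradient P.φ (x P.t_f) ∈ P.Wᗮ
  jump : p₂ τ - p₁ τ + ν • P.normal (x τ) τ = 0
  hamiltonian : P.H₂ (x τ) (p₂ τ) (u₂ τ) τ - P.H₁ (x τ) (p₁ τ) (u₁ τ) τ
    = ν * P.timeSlope (x τ) τ

/-- The same problem with stage costs and terminal cost replaced by zero. -/
def withoutCost {n k : ℕ} (P : SwitchedProblem n k) : SwitchedProblem n k :=
  { P with L₁ := fun _ _ _ => 0, L₂ := fun _ _ _ => 0, φ := fun _ => 0 }

/-- The process is normal: there is no nonzero abnormal co-state, that is, no nonzero co-state for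
the problem with zero cost. -/
def IsNormal {n k : ℕ} (P : SwitchedProblem n k) (x : ℝ → EuclideanSpace ℝ (Fin n))
    (u₁ u₂ : ℝ → EuclideanSpace ℝ (Fin k)) (τ : ℝ) : Prop :=
  ∀ p₁ p₂ ν, P.withoutCost.IsCostate x u₁ u₂ τ p₁ p₂ ν →
    (∀ t ∈ Set.Icc P.t₀ τ, p₁ t = 0) ∧ (∀ t ∈ Set.Icc τ P.t_f, p₂ t = 0)

/-- The jump law `Δλ = -(ΔL + ⟨λ⟩ᵀ Δf) m / ⟨mᵀ f + μ⟩` at the crossing, where `Δ` is the value in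
mode 2 minus the value in mode 1 and `⟨·⟩` is the mean of both. -/
def JumpLaw {n k : ℕ} (P : SwitchedProblem n k) (x : ℝ → EuclideanSpace ℝ (Fin n))
    (u₁ u₂ : ℝ → EuclideanSpace ℝ (Fin k)) (τ : ℝ)
    (p₁ p₂ : ℝ → EuclideanSpace ℝ (Fin n)) : Prop :=
  let m := P.normal (x τ) τ
  let μ := P.timeSlope (x τ) τ
  let a₁ := P.f₁ (x τ) (u₁ τ) τ
  let a₂ := P.f₂ (x τ) (u₂ τ) τ
  let ΔL := P.L₂ (x τ) (u₂ τ) τ - P.L₁ (x τ) (u₁ τ) τ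
  p₂ τ - p₁ τ =
    -((ΔL + inner ℝ ((1 / 2 : ℝ) • (p₁ τ + p₂ τ)) (a₂ - a₁)) /
      ((1 / 2 : ℝ) * ((inner ℝ m a₁ + μ) + (inner ℝ m a₂ + μ)))) • m

end SwitchedProblem

/-! The crossing time is free, so neighbouring processes do not live on the same two time intervals.
Both phases are therefore transported to `[0, 1]` and run in parallel: the state collects the states
and the clocks of the two phases and the accumulated cost, the speeds of the clocks become controls,
and the crossing point `θ` (state and time) becomes a parameter. Phase 2 starts at `θ`; phase 1 must
end at `θ`, with `g = 0` there; phase 2 must end at time `t_f` in the terminal set. This is an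
equality-constrained problem in Mayer form on a Banach space of continuous paths.

Transversality makes the strict sign conditions on `g` stable: paths uniformly close to the optimal
one that satisfy the equality constraints yield admissible processes of the same cost
(`IsAdmissible.eventually_exists_isAdmissible`). Thus the optimal process is a local extremum of the
dilated problem. The linearised state equation is a Volterra equation, hence solvable for every
right-hand side, and the remaining constraints are finite-dimensional. So there are multipliers `Λ`
and `c`, not both zero, and pairing the linearised equation with an adjoint solution `q` gives the
weak maximum principle (`ContinuousMap.exists_costate_of_isLocalExtrOn`).

`exists_isCostate_of_dilated` reads `q` by components. The state components are `λ₁` and `λ₂` up to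
the affine change of time, the cost component is the constant `c`, and stationarity in the clock
speeds makes the clock components equal to `-H₁` and `-H₂`, with costs multiplied by `c`.
Eliminating the multipliers of the matching conditions leaves both crossing conditions, with `ν` the
multiplier of `g = 0`. For `c = 0` the co-state is abnormal; normality makes it vanish,
transversality then gives `ν = 0`, and hence `Λ = 0`, a contradiction. With free terminal state,
uniqueness for the adjoint equation gives normality.

The jump law is algebra: `Δ(λᵀf) = ⟨λ⟩ᵀΔf + Δλᵀ⟨f⟩` and `Δλ = -ν m` turn the Hamiltonian condition
into `ΔL + ⟨λ⟩ᵀΔf = ν ⟨mᵀf + μ⟩`. -/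

open Set Filter Topology MeasureTheory
open scoped unitInterval

namespace ContinuousMap

/-! ### Superposition operators on spaces of continuous maps -/

section Pointwise

variable {K E F : Type*} [TopologicalSpace K] [CompactSpace K]
  [NormedAddCommGroup E] [NormedSpace ℝ E] [NormedAddCommGroup F] [NormedSpace ℝ F]

/-- Pointwise application of a continuous family of operators, as an operator on continuous maps. -/
noncomputable def pointwiseCLM (A : C(K, E →L[ℝ] F)) : C(K, E) →L[ℝ] C(K, F) :=
  LinearMap.mkContinuous
    { toFun := fun y => ⟨fun s => A s (y s), A.continuous.clm_apply y.continuous⟩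
      map_add' := fun y z => by ext s; simp
      map_smul' := fun c y => by ext s; simp } ‖A‖ fun y => by
    refine (ContinuousMap.norm_le _ (by positivity)).2 fun s => ?_
    exact (A s).le_of_opNorm_le_of_le (A.norm_coe_le_norm s) (y.norm_coe_le_norm s)

@[simp] theorem pointwiseCLM_apply (A : C(K, E →L[ℝ] F)) (y : C(K, E)) (s : K) :
    pointwiseCLM A y s = A s (y s) := rfl

/-- Composition with a continuously differentiable map is strictly differentiable on continuous
maps. -/
theorem hasStrictFDerivAt_comp_left {f : E → F} (hf : ContDiff ℝ 1 f) (y : C(K, E)) :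
    HasStrictFDerivAt (fun z : C(K, E) => (⟨f, hf.continuous⟩ : C(E, F)).comp z)
      (pointwiseCLM ⟨fun s => fderiv ℝ f (y s),
        (hf.continuous_fderiv one_ne_zero).comp y.continuous⟩) y := by
  have hdf : Continuous (fderiv ℝ f) := hf.continuous_fderiv one_ne_zero
  have hdiff : Differentiable ℝ f := hf.differentiable one_ne_zero
  rw [hasStrictFDerivAt_iff_isLittleO, Asymptotics.isLittleO_iff]
  intro c hc
  have hK : IsCompact (range y) := isCompact_range y.continuous
  -- Compactness of the range of `y` gives one `δ` for all parameters `s`, so that the mean value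
  -- estimate in the ball around `y s` is uniform in `s`.
  have hunif := hK.uniformContinuousAt_of_continuousAt (fderiv ℝ f)
    (fun x _ => hdf.continuousAt) (Metric.dist_mem_uniformity hc)
  obtain ⟨δ, hδ, hδ'⟩ := Metric.mem_uniformity_dist.1 hunif
  have hball : Metric.ball (y, y) δ ∈ 𝓝 (y, y) := Metric.ball_mem_nhds _ hδ
  filter_upwards [hball] with p hp
  obtain ⟨z, w⟩ := p
  rw [Metric.mem_ball, Prod.dist_eq, max_lt_iff] at hp
  refine (ContinuousMap.norm_le _ (by positivity)).2 fun s => ?_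
  have hmem : ∀ v : C(K, E), dist v y < δ → v s ∈ Metric.ball (y s) δ := fun v hv =>
    (ContinuousMap.dist_apply_le_dist s).trans_lt hv
  have key := (convex_ball (y s) δ).norm_image_sub_le_of_norm_hasFDerivWithin_le'
    (f := f) (f' := fderiv ℝ f) (φ := fderiv ℝ f (y s)) (C := c)
    (fun x _ => (hdiff x).hasFDerivAt.hasFDerivWithinAt)
    (fun x hx => by
      have h1 : dist (y s) x < δ := by rw [dist_comm]; exact hx
      have h2 := hδ' h1 (mem_range_self s)
      rw [← dist_eq_norm, dist_comm]
      exact h2.le) (hmem w hp.2) (hmem z hp.1)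
  refine (show _ = _ from ?_).le.trans (key.trans ?_)
  · rfl
  · gcongr
    exact (z - w).norm_coe_le_norm s

end Pointwise

/-! ### Paths on the unit interval and linear Volterra equations -/

section LineExtend

variable {X : Type*} [TopologicalSpace X]

/-- The extension of a function on the unit interval to the line, constant on both sides. -/
noncomputable def lineExtend (y : C(I, X)) : ℝ → X := Set.IccExtend zero_le_one y

theorem continuous_lineExtend (y : C(I, X)) : Continuous y.lineExtend :=
  y.continuous.Icc_extend'

theorem lineExtend_coe (y : C(I, X)) (s : I) : y.lineExtend s = y s :=
  Set.IccExtend_val zero_le_one y s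

theorem lineExtend_of_mem (y : C(I, X)) {s : ℝ} (hs : s ∈ Icc (0 : ℝ) 1) :
    y.lineExtend s = y ⟨s, hs⟩ :=
  Set.IccExtend_of_mem zero_le_one y hs

theorem lineExtend_zero (y : C(I, X)) : y.lineExtend 0 = y 0 := y.lineExtend_coe 0

theorem lineExtend_one (y : C(I, X)) : y.lineExtend 1 = y 1 := y.lineExtend_coe 1

end LineExtend

section Volterra

variable {E : Type*} [NormedAddCommGroup E] [NormedSpace ℝ E]

/-- The integration operator `y ↦ ∫₀ˢ y`. -/
noncomputable def volterra : C(I, E) →L[ℝ] C(I, E) :=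
  LinearMap.mkContinuous
    { toFun := fun y => ⟨fun s => ∫ r in (0 : ℝ)..s, y.lineExtend r,
        (intervalIntegral.continuous_primitive
          (fun a b => y.continuous_lineExtend.intervalIntegrable a b) 0).comp
          continuous_subtype_val⟩
      map_add' := fun y z => by
        ext s
        exact intervalIntegral.integral_add (y.continuous_lineExtend.intervalIntegrable _ _)
          (z.continuous_lineExtend.intervalIntegrable _ _)
      map_smul' := fun c y => by
        ext s
        exact intervalIntegral.integral_smul c y.lineExtend } 1 fun y => by
    refine (ContinuousMap.norm_le _ (by positivity)).2 fun s => ?_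
    have h := intervalIntegral.norm_integral_le_of_norm_le_const (a := (0 : ℝ)) (b := s)
      (f := y.lineExtend) (C := ‖y‖) fun r _ => y.norm_coe_le_norm _
    refine h.trans ?_
    rw [sub_zero, abs_of_nonneg s.2.1, one_mul]
    exact mul_le_of_le_one_right (norm_nonneg _) s.2.2

theorem volterra_apply (y : C(I, E)) (s : I) :
    volterra y s = ∫ r in (0 : ℝ)..s, y.lineExtend r := rfl

theorem hasDerivAt_integral_lineExtend [CompleteSpace E] (y : C(I, E)) (s : ℝ) :
    HasDerivAt (fun s => ∫ r in (0 : ℝ)..s, y.lineExtend r) (y.lineExtend s) s :=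
  y.continuous_lineExtend.integral_hasStrictDerivAt 0 s |>.hasDerivAt

/-- Each integration of a power bound produces one further factor of the factorial below. -/
theorem norm_volterra_apply_le {y : C(I, E)} {C : ℝ} {n : ℕ}
    (h : ∀ s : I, ‖y s‖ ≤ C * (s : ℝ) ^ n) (s : I) :
    ‖volterra y s‖ ≤ C * ((s : ℝ) ^ (n + 1) / (n + 1)) := by
  rw [volterra_apply]
  have h1 : ‖∫ r in (0 : ℝ)..s, y.lineExtend r‖ ≤ ∫ r in (0 : ℝ)..s, C * r ^ n := by
    refine intervalIntegral.norm_integral_le_of_norm_le s.2.1 ?_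
      ((by fun_prop : Continuous fun r : ℝ => C * r ^ n).intervalIntegrable _ _)
    refine ae_of_all _ fun r hr => ?_
    have hr' : r ∈ Icc (0 : ℝ) 1 := ⟨hr.1.le, hr.2.trans s.2.2⟩
    rw [lineExtend_of_mem y hr']
    exact h ⟨r, hr'⟩
  refine h1.trans_eq ?_
  rw [intervalIntegral.integral_const_mul, integral_pow]
  simp

/-- The factorial beats every power of `‖A‖`, so some iterate is a contraction without any smallness
of `A`. -/
theorem norm_iterate_volterra_le (A : C(I, E →L[ℝ] E)) (y : C(I, E)) (n : ℕ) (s : I) :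
    ‖((volterra.comp (pointwiseCLM A)) ^ n) y s‖ ≤ ‖A‖ ^ n / n.factorial * ‖y‖ * (s : ℝ) ^ n := by
  induction n generalizing s with
  | zero => simpa using y.norm_coe_le_norm s
  | succ n ih =>
    rw [pow_succ']
    have h := norm_volterra_apply_le
      (y := pointwiseCLM A (((volterra.comp (pointwiseCLM A)) ^ n) y))
      (C := ‖A‖ * (‖A‖ ^ n / n.factorial * ‖y‖)) (n := n) (fun s => by
        rw [mul_assoc]
        exact (A s).le_of_opNorm_le_of_le (A.norm_coe_le_norm s) (ih s)) s
    refine h.trans_eq ?_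
    rw [Nat.factorial_succ]
    push_cast
    field_simp
    ring

variable [CompleteSpace E]

/-- A linear Volterra equation of the second kind is solvable. -/
theorem exists_eq_add_volterra (A : C(I, E →L[ℝ] E)) (a : C(I, E)) :
    ∃ y : C(I, E), y = a + volterra (pointwiseCLM A y) := by
  set T : C(I, E) →L[ℝ] C(I, E) := volterra.comp (pointwiseCLM A)
  obtain ⟨n, hn⟩ : ∃ n : ℕ, ‖A‖ ^ n / n.factorial < 1 :=
    ((FloorSemiring.tendsto_pow_div_factorial_atTop ‖A‖).eventually
      (gt_mem_nhds one_pos)).exists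
  have hnorm : ‖T ^ n‖ < 1 := by
    refine lt_of_le_of_lt (ContinuousLinearMap.opNorm_le_bound _ (by positivity) fun y => ?_) hn
    refine (ContinuousMap.norm_le _ (by positivity)).2 fun s => ?_
    refine (norm_iterate_volterra_le A y n s).trans ?_
    exact mul_le_of_le_one_right (by positivity) (pow_le_one₀ s.2.1 s.2.2)
  have hunit : IsUnit (1 - T ^ n) :=
    @isUnit_one_sub_of_norm_lt_one (C(I, E) →L[ℝ] C(I, E)) _ _ (T ^ n) hnorm
  obtain ⟨R, hR⟩ := hunit.exists_right_inv
  -- `T` itself need not be a contraction, but `(1 - T) ∑ Tⁱ = 1 - Tⁿ`, so a right inverse of `1 -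
  -- Tⁿ` yields one of `1 - T`.
  refine ⟨(∑ i ∈ Finset.range n, T ^ i) (R a), ?_⟩
  have h1 : (1 - T) * ((∑ i ∈ Finset.range n, T ^ i) * R) = 1 := by
    rw [← mul_assoc, mul_neg_geom_sum, hR]
  have h2 := congrArg (fun B : C(I, E) →L[ℝ] C(I, E) => B a) h1
  exact sub_eq_iff_eq_add.1 h2

/-- Solution of a linear differential equation on the unit interval with given value at `1`. -/
theorem exists_linear_ode_of_terminal (A : C(I, E →L[ℝ] E)) (b : E) :
    ∃ y : C(I, E), y 1 = b ∧ ∀ t ∈ Icc (0 : ℝ) 1,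
      HasDerivWithinAt y.lineExtend (A.lineExtend t (y.lineExtend t)) (Icc 0 1) t := by
  -- The reflection `s ↦ 1 - s` turns the terminal value into an initial value and changes the sign
  -- of `A`.
  obtain ⟨z, hz⟩ := exists_eq_add_volterra
    (-(A.comp ⟨unitInterval.symm, unitInterval.continuous_symm⟩)) (ContinuousMap.const I b)
  set w := pointwiseCLM (-(A.comp ⟨unitInterval.symm, unitInterval.continuous_symm⟩)) z with hw
  have hz' : ∀ s : I, z s = b + ∫ r in (0 : ℝ)..s, w.lineExtend r := fun s =>
    congrArg (fun f : C(I, E) => f s) hz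
  refine ⟨z.comp ⟨unitInterval.symm, unitInterval.continuous_symm⟩, ?_, fun t ht => ?_⟩
  · simp [hz' 0]
  · have hmem : ∀ r ∈ Icc (0 : ℝ) 1, 1 - r ∈ Icc (0 : ℝ) 1 := fun r hr =>
      ⟨by linarith [hr.2], by linarith [hr.1]⟩
    have h1 : HasDerivAt (fun r : ℝ => b + ∫ s in (0 : ℝ)..(1 - r), w.lineExtend s)
        (-(w.lineExtend (1 - t))) t := by
      have := (w.hasDerivAt_integral_lineExtend (1 - t)).scomp t
        ((hasDerivAt_id t).const_sub 1)
      simpa [Function.comp_def] using this.const_add b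
    have heq : ∀ r ∈ Icc (0 : ℝ) 1,
        (z.comp ⟨unitInterval.symm, unitInterval.continuous_symm⟩).lineExtend r
          = b + ∫ s in (0 : ℝ)..(1 - r), w.lineExtend s := fun r hr => by
      rw [lineExtend_of_mem _ hr]
      exact hz' ⟨1 - r, hmem r hr⟩
    have hval : A.lineExtend t ((z.comp
        ⟨unitInterval.symm, unitInterval.continuous_symm⟩).lineExtend t)
          = -(w.lineExtend (1 - t)) := by
      rw [lineExtend_of_mem _ ht, lineExtend_of_mem _ ht, lineExtend_of_mem _ (hmem t ht)]
      simp [hw, unitInterval.symm]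
    rw [hval]
    exact h1.hasDerivWithinAt.congr heq (heq t ht)

end Volterra

end ContinuousMap

theorem intervalIntegral.integral_eq_sub_of_hasDerivWithinAt_Icc {E : Type*}
    [NormedAddCommGroup E] [NormedSpace ℝ E] [CompleteSpace E] {f f' : ℝ → E} {a b : ℝ}
    (hab : a ≤ b) (hf : ∀ t ∈ Icc a b, HasDerivWithinAt f (f' t) (Icc a b) t)
    (hf' : ContinuousOn f' (Icc a b)) : ∫ t in a..b, f' t = f b - f a :=
  intervalIntegral.integral_eq_sub_of_hasDerivAt_of_le hab
    (fun t ht => (hf t ht).continuousWithinAt)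
    (fun t ht => (hf t (Ioo_subset_Icc_self ht)).hasDerivAt (Icc_mem_nhds ht.1 ht.2))
    (hf'.intervalIntegrable_of_Icc hab)

/-! ### Lagrange multipliers -/

/-- Lagrange multipliers for a pair of constraints, one of them with surjective derivative, the
other one with values in a finite-dimensional space. -/
theorem IsLocalExtrOn.exists_multiplier_of_surjective {X G Y : Type*}
    [NormedAddCommGroup X] [NormedSpace ℝ X] [CompleteSpace X]
    [NormedAddCommGroup G] [NormedSpace ℝ G] [CompleteSpace G]
    [NormedAddCommGroup Y] [NormedSpace ℝ Y] [FiniteDimensional ℝ Y]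
    {f : X → G} {g : X → Y} {φ : X → ℝ} {x₀ : X}
    {f' : X →L[ℝ] G} {g' : X →L[ℝ] Y} {φ' : X →L[ℝ] ℝ}
    (hextr : IsLocalExtrOn φ {x | f x = f x₀ ∧ g x = g x₀} x₀)
    (hf : HasStrictFDerivAt f f' x₀) (hg : HasStrictFDerivAt g g' x₀)
    (hφ : HasStrictFDerivAt φ φ' x₀) (hsurj : Function.Surjective f') :
    ∃ (Λ : Y →L[ℝ] ℝ) (c : ℝ), (c = 1 ∨ c = 0 ∧ Λ ≠ 0) ∧
      ∀ x, f' x = 0 → Λ (g' x) + c * φ' x = 0 := by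
  suffices h : ∃ (Λ : Y →L[ℝ] ℝ) (c : ℝ), ¬(Λ = 0 ∧ c = 0) ∧
      ∀ x, f' x = 0 → Λ (g' x) + c * φ' x = 0 by
    obtain ⟨Λ, c, hne, h⟩ := h
    by_cases hc : c = 0
    · exact ⟨Λ, c, Or.inr ⟨hc, fun hΛ => hne ⟨hΛ, hc⟩⟩, h⟩
    · refine ⟨c⁻¹ • Λ, 1, Or.inl rfl, fun x hx => ?_⟩
      have h1 := congrArg (c⁻¹ * ·) (h x hx)
      simpa [mul_add, hc] using h1
  have : CompleteSpace Y := FiniteDimensional.complete ℝ Y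
  have hextr' : IsLocalExtrOn φ {x | (f x, g x) = (f x₀, g x₀)} x₀ := by
    simpa only [Prod.mk.injEq] using hextr
  have hrange := hextr'.range_ne_top_of_hasStrictFDerivAt (hf.prodMk hg) hφ
  -- Since `f'` is onto, the triple of derivatives would be onto if the kernel of `f'` already
  -- covered `Y × ℝ`. So `S` is proper, and a nonzero functional that kills it supplies `Λ` and `c`;
  -- finite dimension of `Y` makes `Λ` continuous.
  set S : Submodule ℝ (Y × ℝ) :=
    (LinearMap.ker f'.toLinearMap).map ((g'.prod φ').toLinearMap)
  have hStop : S ≠ ⊤ := by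
    intro htop
    apply hrange
    rw [eq_top_iff]
    rintro ⟨⟨a, b⟩, r⟩ -
    obtain ⟨x, hx⟩ := hsurj a
    have hmem : (b - g' x, r - φ' x) ∈ S := htop ▸ Submodule.mem_top
    obtain ⟨y, hy, hy'⟩ := hmem
    have hy0 : f' y = 0 := hy
    have hy1 : g' y = b - g' x := congrArg Prod.fst hy'
    have hy2 : φ' y = r - φ' x := congrArg Prod.snd hy'
    refine ⟨x + y, ?_⟩
    simp [hx, hy0, hy1, hy2]
  obtain ⟨ℓ, hℓ, hℓS⟩ := Submodule.exists_le_ker_of_lt_top S (lt_top_iff_ne_top.2 hStop)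
  have hsplit : ∀ y r, ℓ (y, r) = ℓ (y, 0) + ℓ (0, 1) * r := fun y r => by
    have : (y, r) = (y, (0 : ℝ)) + r • ((0 : Y), (1 : ℝ)) := by simp
    rw [this, map_add, map_smul, smul_eq_mul, mul_comm]
  refine ⟨(ℓ.comp (LinearMap.inl ℝ Y ℝ)).toContinuousLinearMap, ℓ (0, 1), ?_, fun x hx => ?_⟩
  · rintro ⟨h1, h2⟩
    refine hℓ (LinearMap.ext fun p => ?_)
    have h3 : ℓ (p.1, 0) = 0 := congrArg (fun L : Y →L[ℝ] ℝ => L p.1) h1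
    have h4 := hsplit p.1 p.2
    rw [h3, h2] at h4
    simpa using h4
  · have h1 : ℓ (g' x, φ' x) = 0 := hℓS ⟨x, hx, rfl⟩
    rw [hsplit] at h1
    exact h1

/-! ### Weak maximum principle in Mayer form -/

namespace ContinuousMap

/-- Weak maximum principle for a problem in Mayer form on the unit interval, with the initial value
`z₀ + ι θ` depending on a parameter `θ`, with constraints `Ψ(θ, z(1)) = const` and with performance
index `Φ(θ, z(1))`. -/
theorem exists_costate_of_isLocalExtrOn {Θ Z U Y : Type*}
    [NormedAddCommGroup Θ] [NormedSpace ℝ Θ] [CompleteSpace Θ]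
    [NormedAddCommGroup Z] [NormedSpace ℝ Z] [CompleteSpace Z]
    [NormedAddCommGroup U] [NormedSpace ℝ U] [CompleteSpace U]
    [NormedAddCommGroup Y] [NormedSpace ℝ Y] [FiniteDimensional ℝ Y]
    {F : Z × U → Z} (hF : ContDiff ℝ 1 F) (z₀ : Z) (ι : Θ →L[ℝ] Z)
    {Ψ : Θ × Z → Y} (hΨ : ContDiff ℝ 1 Ψ) {Φ : Θ × Z → ℝ} (hΦ : ContDiff ℝ 1 Φ)
    (θ : Θ) (γ : C(I, Z × U))
    (hγ : ∀ s, (γ s).1 = z₀ + ι θ + volterra ((⟨F, hF.continuous⟩ : C(Z × U, Z)).comp γ) s)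
    (hextr : IsLocalExtrOn (fun p : Θ × C(I, Z × U) => Φ (p.1, (p.2 1).1))
      {p | (∀ s, (p.2 s).1
          = z₀ + ι p.1 + volterra ((⟨F, hF.continuous⟩ : C(Z × U, Z)).comp p.2) s) ∧
        Ψ (p.1, (p.2 1).1) = Ψ (θ, (γ 1).1)} (θ, γ)) :
    ∃ (Λ : Y →L[ℝ] ℝ) (c : ℝ) (q : C(I, Z →L[ℝ] ℝ)), (c = 1 ∨ c = 0 ∧ Λ ≠ 0) ∧
      (∀ t ∈ Icc (0 : ℝ) 1, HasDerivWithinAt q.lineExtend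
        (-((q.lineExtend t).comp ((fderiv ℝ F (γ.lineExtend t)).comp
          (ContinuousLinearMap.inl ℝ Z U)))) (Icc 0 1) t) ∧
      (∀ δ, q 1 δ = Λ (fderiv ℝ Ψ (θ, (γ 1).1) (0, δ)) + c * fderiv ℝ Φ (θ, (γ 1).1) (0, δ)) ∧
      (∀ δ, q 0 (ι δ)
        = -(Λ (fderiv ℝ Ψ (θ, (γ 1).1) (δ, 0)) + c * fderiv ℝ Φ (θ, (γ 1).1) (δ, 0))) ∧
      ∀ s δ, q s (fderiv ℝ F (γ s) (0, δ)) = 0 := by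
  set N : C(I, Z × U) → C(I, Z) := fun δ => (⟨F, hF.continuous⟩ : C(Z × U, Z)).comp δ
  set D : C(I, Z × U →L[ℝ] Z) := ⟨fun s => fderiv ℝ F (γ s),
    (hF.continuous_fderiv one_ne_zero).comp γ.continuous⟩
  set X := Θ × C(I, Z × U)
  set π : X →L[ℝ] C(I, Z × U) := ContinuousLinearMap.snd ℝ Θ C(I, Z × U)
  set st : X →L[ℝ] C(I, Z) :=
    (pointwiseCLM (ContinuousMap.const I (ContinuousLinearMap.fst ℝ Z U))).comp π
  set cst : Z →L[ℝ] C(I, Z) := LinearMap.mkContinuous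
    { toFun := fun z => ContinuousMap.const I z
      map_add' := fun _ _ => rfl
      map_smul' := fun _ _ => rfl } 1 fun z => by
        rw [one_mul]
        exact (ContinuousMap.norm_le _ (norm_nonneg _)).2 fun s => le_rfl
  set ini : X →L[ℝ] C(I, Z) := (cst.comp ι).comp (ContinuousLinearMap.fst ℝ Θ C(I, Z × U))
  set ends : X →L[ℝ] Θ × Z := (ContinuousLinearMap.fst ℝ Θ C(I, Z × U)).prod
    ((ContinuousMap.evalCLM ℝ (1 : I)).comp st)
  -- The state equation in integrated form, as the zero set of a residual: no derivative of the path
  -- is needed, so uniformly continuous perturbations of state and control form the whole Banach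
  -- space.
  set f : X → C(I, Z) := fun p => st p - (cst z₀ + ini p) - volterra (N p.2)
  set f' : X →L[ℝ] C(I, Z) := st - ini - volterra.comp ((pointwiseCLM D).comp π) with hf'
  have hfd : HasStrictFDerivAt f f' (θ, γ) := by
    have h1 : HasStrictFDerivAt (fun p : X => N p.2) ((pointwiseCLM D).comp π) (θ, γ) :=
      (hasStrictFDerivAt_comp_left hF γ).comp (f := fun p : X => p.2) (θ, γ) π.hasStrictFDerivAt
    exact (st.hasStrictFDerivAt.sub (ini.hasStrictFDerivAt.const_add (cst z₀))).sub
      (volterra.hasStrictFDerivAt.comp (θ, γ) h1)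
  have hgd : HasStrictFDerivAt (fun p : X => Ψ (ends p))
      ((fderiv ℝ Ψ (θ, (γ 1).1)).comp ends) (θ, γ) :=
    (hΨ.contDiffAt.hasStrictFDerivAt (x := ends (θ, γ)) one_ne_zero).comp (θ, γ)
      ends.hasStrictFDerivAt
  have hφd : HasStrictFDerivAt (fun p : X => Φ (ends p))
      ((fderiv ℝ Φ (θ, (γ 1).1)).comp ends) (θ, γ) :=
    (hΦ.contDiffAt.hasStrictFDerivAt (x := ends (θ, γ)) one_ne_zero).comp (θ, γ)
      ends.hasStrictFDerivAt
  have hfiff : ∀ p : X, f p = 0 ↔ ∀ s, (p.2 s).1 = z₀ + ι p.1 + volterra (N p.2) s := fun p => by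
    change st p - (cst z₀ + ini p) - volterra (N p.2) = 0 ↔ _
    rw [sub_sub, sub_eq_zero, ContinuousMap.ext_iff]
    rfl
  have hf0 : f (θ, γ) = 0 := (hfiff _).2 hγ
  set A : C(I, Z →L[ℝ] Z) := ⟨fun s => (D s).comp (ContinuousLinearMap.inl ℝ Z U),
    D.continuous.clm_comp continuous_const⟩
  -- Varying the state alone suffices: the linearised residual is then `y - volterra (A y)`.
  have hsurj : Function.Surjective f' := fun a => by
    obtain ⟨y, hy⟩ := exists_eq_add_volterra A a
    set p : X := (0, ⟨fun s => (y s, 0), y.continuous.prodMk continuous_const⟩)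
    refine ⟨p, ?_⟩
    have h1 : st p = y := rfl
    have h2 : ini p = 0 := by
      change cst (ι 0) = 0
      rw [map_zero, map_zero]
    have h3 : pointwiseCLM D (π p) = pointwiseCLM A y := rfl
    have h4 : f' p = y - volterra (pointwiseCLM A y) := by
      simp only [hf', _root_.sub_apply, ContinuousLinearMap.comp_apply, h1, h2, h3,
        sub_zero]
    rw [h4]
    exact sub_eq_iff_eq_add.2 hy
  obtain ⟨Λ, c, hne, hann⟩ := IsLocalExtrOn.exists_multiplier_of_surjective
    (f := f) (g := fun p => Ψ (ends p)) (φ := fun p => Φ (ends p)) (x₀ := (θ, γ))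
    (by
      rw [hf0]
      convert! hextr using 1
      ext p
      exact and_congr (hfiff p) Iff.rfl) hfd hgd hφd hsurj
  set b : (Θ × Z) →L[ℝ] ℝ :=
    Λ.comp (fderiv ℝ Ψ (θ, (γ 1).1)) + c • fderiv ℝ Φ (θ, (γ 1).1)
  have hann' : ∀ p, f' p = 0 → b (ends p) = 0 := hann
  obtain ⟨q, hq1, hq⟩ := exists_linear_ode_of_terminal
    (⟨fun s => -((ContinuousLinearMap.compL ℝ Z Z ℝ).flip (A s)), by fun_prop⟩ :
      C(I, (Z →L[ℝ] ℝ) →L[ℝ] (Z →L[ℝ] ℝ))) (b.comp (ContinuousLinearMap.inr ℝ Θ Z))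
  have hqd : ∀ t ∈ Icc (0 : ℝ) 1, HasDerivWithinAt q.lineExtend
      (-((q.lineExtend t).comp (A.lineExtend t))) (Icc 0 1) t := hq
  set B : C(I, U →L[ℝ] ℝ) := ⟨fun s => (q s).comp ((D s).comp (ContinuousLinearMap.inr ℝ Z U)),
    q.continuous.clm_comp (D.continuous.clm_comp continuous_const)⟩ with hB
  -- Green's identity: for the linearised state `y` driven by `δ` and `u`, the adjoint equation
  -- cancels the state terms in the derivative of `q y` and leaves `B u`. Integrating and inserting
  -- `b (δ, y 1) = 0` with `q 1 = b (0, ·)` gives the claim for arbitrary `δ` and `u`.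
  have hgreen : ∀ (δ : Θ) (u : C(I, U)), b (δ, 0) + q 0 (ι δ)
      + ∫ s in (0 : ℝ)..1, (pointwiseCLM B u).lineExtend s = 0 := by
    intro δ u
    obtain ⟨y, hy⟩ := exists_eq_add_volterra A (cst (ι δ) + volterra (pointwiseCLM
      (D.comp (ContinuousMap.id I)) ⟨fun s => (0, u s), continuous_const.prodMk u.continuous⟩))
    set w : C(I, Z) := pointwiseCLM D ⟨fun s => (y s, u s), y.continuous.prodMk u.continuous⟩
    have hws : ∀ s, w s = A s (y s) + D s (0, u s) := fun s => by
      change D s (y s, u s) = D s (y s, 0) + D s (0, u s)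
      rw [← map_add, Prod.mk_add_mk, add_zero, zero_add]
    have hyw : y = cst (ι δ) + volterra w := by
      have : w = pointwiseCLM A y + pointwiseCLM (D.comp (ContinuousMap.id I))
          ⟨fun s => (0, u s), continuous_const.prodMk u.continuous⟩ := ContinuousMap.ext hws
      rw [this, map_add, ← add_assoc, add_right_comm]
      exact hy
    have hker := hann' (δ, ⟨fun s => (y s, u s), y.continuous.prodMk u.continuous⟩) (by
      change y - cst (ι δ) - volterra w = 0
      rw [sub_sub, sub_eq_zero]
      exact hyw)
    have hker' : b (δ, y 1) = 0 := hker
    have hys : ∀ t ∈ Icc (0 : ℝ) 1,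
        HasDerivWithinAt y.lineExtend (w.lineExtend t) (Icc 0 1) t := fun t ht => by
      have hval : ∀ r ∈ Icc (0 : ℝ) 1,
          y.lineExtend r = ι δ + ∫ s in (0 : ℝ)..r, w.lineExtend s := fun r hr => by
        rw [lineExtend_of_mem y hr]
        exact congrArg (fun z : C(I, Z) => z ⟨r, hr⟩) hyw
      exact ((w.hasDerivAt_integral_lineExtend t).const_add (ι δ)).hasDerivWithinAt.congr
        hval (hval t ht)
    have hint := intervalIntegral.integral_eq_sub_of_hasDerivWithinAt_Icc zero_le_one
      (f := fun t => q.lineExtend t (y.lineExtend t)) (f' := (pointwiseCLM B u).lineExtend)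
      (fun t ht => by
        convert! (hqd t ht).clm_apply (hys t ht) using 1
        simp only [lineExtend_of_mem _ ht, hws]
        simp [hB]) (continuous_lineExtend _).continuousOn
    have hy0 : y 0 = ι δ := by
      have : volterra w 0 = 0 := by simp [volterra_apply]
      rw [hyw, ContinuousMap.add_apply, this, add_zero]
      rfl
    have hsum : b (δ, y 1) = b (δ, 0) + b (0, y 1) := by
      rw [← map_add, Prod.mk_add_mk, add_zero, zero_add]
    have hq1' : q 1 (y 1) = b (0, y 1) := by rw [hq1]; rfl
    simp only [lineExtend_zero, lineExtend_one] at hint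
    rw [hint, hy0, hq1']
    linarith
  have hq0 : ∀ δ, b (δ, 0) + q 0 (ι δ) = 0 := fun δ => by
    have := hgreen δ 0
    have h0 : ∀ s, (0 : C(I, ℝ)).lineExtend s = 0 := fun s => rfl
    simpa only [(pointwiseCLM B).map_zero, h0, intervalIntegral.integral_zero, add_zero] using this
  refine ⟨Λ, c, q, hne, hqd, fun δ => ?_, fun δ => ?_, fun s δ => ?_⟩
  · rw [hq1]
    rfl
  · rw [eq_neg_iff_add_eq_zero, add_comm]
    exact hq0 δ
  -- The control variation `h • δ` makes the integrand in Green's identity equal to `h²`, so `h`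
  -- must vanish everywhere.
  · set h : C(I, ℝ) := ⟨fun s => B s δ, by fun_prop⟩ with hh
    have h1 := hgreen 0 ⟨fun s => h s • δ, by fun_prop⟩
    rw [hq0, zero_add] at h1
    by_contra hne0
    have hpos : 0 < ∫ s in (0 : ℝ)..1,
        (pointwiseCLM B ⟨fun s => h s • δ, by fun_prop⟩).lineExtend s := by
      have hval : ∀ r : I, pointwiseCLM B ⟨fun s => h s • δ, by fun_prop⟩ r = h r * h r :=
        fun r => by simp [hh]
      refine intervalIntegral.integral_pos zero_lt_one (continuous_lineExtend _).continuousOn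
        (fun r hr => ?_) ⟨s, s.2, ?_⟩
      · rw [lineExtend_of_mem _ (Ioc_subset_Icc_self hr), hval]
        exact mul_self_nonneg _
      · rw [lineExtend_coe, hval]
        exact mul_self_pos.2 hne0
    exact hpos.ne' h1

end ContinuousMap

/-! ### Inverting clocks, stability of one-sided crossings, and time rescaling -/

/-- A function on the line with derivative bounded below by a positive constant has a
differentiable inverse. -/
theorem exists_hasDerivAt_inverse_of_le_deriv {T w : ℝ → ℝ} {ε : ℝ} (hε : 0 < ε)
    (hw : ∀ s, ε ≤ w s) (hT : ∀ s, HasDerivAt T (w s) s) :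
    ∃ S : ℝ → ℝ, StrictMono S ∧ (∀ s, S (T s) = s) ∧ (∀ t, T (S t) = t) ∧
      ∀ t, HasDerivAt S (w (S t))⁻¹ t := by
  have hdiff : Differentiable ℝ T := fun s => (hT s).differentiableAt
  have hderiv : ∀ s, deriv T s = w s := fun s => (hT s).deriv
  have hmono : StrictMono T := strictMono_of_deriv_pos fun s => by
    rw [hderiv]
    exact hε.trans_le (hw s)
  have hgrow : ∀ ⦃a b : ℝ⦄, a ≤ b → ε * (b - a) ≤ T b - T a := fun a b hab =>
    mul_sub_le_image_sub_of_le_deriv hdiff (fun s => (hw s).trans_eq (hderiv s).symm) hab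
  have hsurj : Function.Surjective T := by
    refine hdiff.continuous.surjective ?_ ?_
    · refine tendsto_atTop_mono' atTop ?_
        (tendsto_atTop_add_const_right _ (T 0) (tendsto_id.const_mul_atTop hε))
      filter_upwards [eventually_ge_atTop 0] with s hs
      have := hgrow hs
      simp only [id]
      linarith
    · refine tendsto_atBot_mono' atBot ?_
        (tendsto_atBot_add_const_right _ (T 0) (tendsto_id.const_mul_atBot hε))
      filter_upwards [eventually_le_atBot 0] with s hs
      have := hgrow hs
      simp only [id]
      linarith
  set e := hmono.orderIsoOfSurjective T hsurj
  have hTe : ∀ s, T s = e s := fun s => rfl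
  refine ⟨e.symm, e.symm.strictMono, fun s => ?_, fun t => ?_, fun t => ?_⟩
  · rw [hTe, e.symm_apply_apply]
  · rw [hTe, e.apply_symm_apply]
  · refine (hT (e.symm t)).of_local_left_inverse e.symm.continuous.continuousAt
      (hε.trans_le (hw _)).ne' (Eventually.of_forall fun r => ?_)
    rw [hTe, e.apply_symm_apply]

namespace ContinuousMap

/-- A path along which `h` is negative before it ends on `h = 0`, with positive speed there: nearby
paths which end on `h = 0` have this property, too. -/
theorem eventually_neg_of_hasDerivWithinAt {X : Type*} [TopologicalSpace X] {h D : X → ℝ}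
    (hh : Continuous h) (hD : Continuous D) {γ₀ : C(I, X)} (hneg : ∀ s, s < 1 → h (γ₀ s) < 0)
    (hpos : 0 < D (γ₀ 1)) :
    ∀ᶠ γ in 𝓝 γ₀, h (γ 1) = 0 →
      (∀ s ∈ Icc (0 : ℝ) 1, HasDerivWithinAt (fun r => h (γ.lineExtend r))
        (D (γ.lineExtend s)) (Icc 0 1) s) → ∀ s ∈ Ico (0 : ℝ) 1, h (γ.lineExtend s) < 0 := by
  have hev : ∀ᶠ s in 𝓝[<] (1 : ℝ), ∀ r ∈ Icc s 1, 0 < D (γ₀.lineExtend r) := by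
    have h1 : ∀ᶠ r in 𝓝 (1 : ℝ), 0 < D (γ₀.lineExtend r) := by
      refine (hD.comp γ₀.continuous_lineExtend).continuousAt.eventually_const_lt ?_
      simpa only [Function.comp_apply, lineExtend_one] using hpos
    obtain ⟨ε, hε, h2⟩ := Metric.eventually_nhds_iff.1 h1
    filter_upwards [Ioo_mem_nhdsLT (show 1 - ε < 1 by linarith)] with s hs r hr
    refine h2 ?_
    rw [Real.dist_eq, abs_lt]
    constructor <;> linarith [hs.1, hr.1, hr.2]
  -- Uniform closeness alone cannot keep `h` negative near the end, where it tends to `0`. The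
  -- interval is split at `a`: before `a`, compactness preserves `h < 0`; after `a`, it preserves `0
  -- < D`, so `h` increases strictly to its end value `0`.
  obtain ⟨a, ha, ha0, ha1⟩ :=
    (hev.and (Ioo_mem_nhdsLT (show (0 : ℝ) < 1 from zero_lt_one))).exists
  have hK₁ : IsCompact {s : I | (s : ℝ) ≤ a} :=
    (isClosed_le continuous_subtype_val continuous_const).isCompact
  have hK₂ : IsCompact {s : I | a ≤ (s : ℝ)} :=
    (isClosed_le continuous_const continuous_subtype_val).isCompact
  have hm₁ : MapsTo γ₀ {s : I | (s : ℝ) ≤ a} {x | h x < 0} := fun s hs =>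
    hneg s (Subtype.coe_lt_coe.1 (lt_of_le_of_lt hs ha1))
  have hm₂ : MapsTo γ₀ {s : I | a ≤ (s : ℝ)} {x | 0 < D x} := fun s hs => by
    have := ha s ⟨hs, s.2.2⟩
    rwa [lineExtend_coe] at this
  filter_upwards [ContinuousMap.eventually_mapsTo hK₁ (isOpen_lt hh continuous_const) hm₁,
    ContinuousMap.eventually_mapsTo hK₂ (isOpen_lt continuous_const hD) hm₂]
    with γ hγ₁ hγ₂ hend hderiv s hs
  rcases le_or_gt s a with hsa | hsa
  · rw [lineExtend_of_mem γ (Ico_subset_Icc_self hs)]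
    exact hγ₁ (show ((⟨s, Ico_subset_Icc_self hs⟩ : I) : ℝ) ≤ a from hsa)
  · have hmono : StrictMonoOn (fun r => h (γ.lineExtend r)) (Icc a 1) := by
      refine strictMonoOn_of_deriv_pos (convex_Icc a 1)
        (hh.comp γ.continuous_lineExtend).continuousOn fun r hr => ?_
      rw [interior_Icc] at hr
      have hr01 : r ∈ Ioo (0 : ℝ) 1 := ⟨ha0.trans hr.1, hr.2⟩
      rw [((hderiv r (Ioo_subset_Icc_self hr01)).hasDerivAt (Icc_mem_nhds hr01.1 hr01.2)).deriv,
        lineExtend_of_mem γ (Ioo_subset_Icc_self hr01)]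
      exact hγ₂ (show a ≤ ((⟨r, Ioo_subset_Icc_self hr01⟩ : I) : ℝ) from hr.1.le)
    have h1 := hmono ⟨hsa.le, hs.2.le⟩ ⟨ha1.le, le_rfl⟩ hs.2
    simp only [lineExtend_one, hend] at h1
    exact h1

/-- A path along which `h` is positive after it starts on `h = 0`, with positive speed there: nearby
paths which start on `h = 0` have this property, too. -/
theorem eventually_pos_of_hasDerivWithinAt {X : Type*} [TopologicalSpace X] {h D : X → ℝ}
    (hh : Continuous h) (hD : Continuous D) {γ₀ : C(I, X)} (hneg : ∀ s, 0 < s → 0 < h (γ₀ s))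
    (hpos : 0 < D (γ₀ 0)) :
    ∀ᶠ γ in 𝓝 γ₀, h (γ 0) = 0 →
      (∀ s ∈ Icc (0 : ℝ) 1, HasDerivWithinAt (fun r => h (γ.lineExtend r))
        (D (γ.lineExtend s)) (Icc 0 1) s) → ∀ s ∈ Ioc (0 : ℝ) 1, 0 < h (γ.lineExtend s) := by
  set ρ : C(I, I) := ⟨unitInterval.symm, unitInterval.continuous_symm⟩ with hρ
  -- Reversing the path and negating `h` changes the sign of the speed twice, so `D` stays the same.
  have hev := eventually_neg_of_hasDerivWithinAt (h := fun x => -h x) (D := D) hh.neg hD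
    (γ₀ := γ₀.comp ρ)
    (fun s hs => neg_lt_zero.2 (hneg _ (by
      rw [← Subtype.coe_lt_coe] at hs ⊢
      simpa [hρ] using hs))) (by simpa [hρ] using hpos)
  have htend : Tendsto (fun γ : C(I, X) => γ.comp ρ) (𝓝 γ₀) (𝓝 (γ₀.comp ρ)) :=
    (ContinuousMap.continuous_precomp ρ).continuousAt
  filter_upwards [htend.eventually hev] with γ hγ h0 hderiv s hs
  have hmem : ∀ r ∈ Icc (0 : ℝ) 1, 1 - r ∈ Icc (0 : ℝ) 1 := fun r hr =>
    ⟨by linarith [hr.2], by linarith [hr.1]⟩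
  have hval : ∀ r ∈ Icc (0 : ℝ) 1, (γ.comp ρ).lineExtend r = γ.lineExtend (1 - r) := fun r hr => by
    rw [lineExtend_of_mem _ hr, lineExtend_of_mem _ (hmem r hr)]
    rfl
  have h1 := hγ (by simp [hρ, h0]) (fun r hr => by
    have h2 := ((hderiv (1 - r) (hmem r hr)).scomp r
      ((hasDerivWithinAt_id r (Icc 0 1)).const_sub 1) (fun r hr => hmem r hr)).neg
    simp only [neg_smul, one_smul, neg_neg] at h2
    rw [hval r hr]
    exact h2.congr (fun r hr => by simp [hval r hr]) (by simp [hval r hr]))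
    (1 - s) ⟨by linarith [hs.2], by linarith [hs.1]⟩
  rw [hval _ (hmem s (Ioc_subset_Icc_self hs)), sub_sub_cancel, neg_lt_zero] at h1
  exact h1

end ContinuousMap

/-- The left derivative of a function which is negative before it vanishes is nonnegative. -/
theorem HasDerivWithinAt.nonneg_of_neg_of_eq_zero {h : ℝ → ℝ} {d a b : ℝ} (hab : a < b)
    (hd : HasDerivWithinAt h d (Icc a b) b) (hneg : ∀ t ∈ Ico a b, h t < 0) (hb : h b = 0) :
    0 ≤ d := by
  have h1 := hasDerivWithinAt_iff_tendsto_slope.1 hd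
  rw [Icc_sdiff_right] at h1
  have : (𝓝[Ico a b] b).NeBot := by
    rw [nhdsWithin_Ico_eq_nhdsLT hab]
    infer_instance
  refine ge_of_tendsto h1 (eventually_nhdsWithin_of_forall fun t ht => ?_)
  rw [slope_def_field, hb]
  exact div_nonneg_of_nonpos (by linarith [hneg t ht]) (by linarith [ht.2])

/-- The right derivative of a function which is positive after it vanishes is nonnegative. -/
theorem HasDerivWithinAt.nonneg_of_eq_zero_of_pos {h : ℝ → ℝ} {d a b : ℝ} (hab : a < b)
    (hd : HasDerivWithinAt h d (Icc a b) a) (hpos : ∀ t ∈ Ioc a b, 0 < h t) (ha : h a = 0) :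
    0 ≤ d := by
  have h1 := hasDerivWithinAt_iff_tendsto_slope.1 hd
  rw [Icc_sdiff_left] at h1
  have : (𝓝[Ioc a b] a).NeBot := by
    rw [nhdsWithin_Ioc_eq_nhdsGT hab]
    infer_instance
  refine ge_of_tendsto h1 (eventually_nhdsWithin_of_forall fun t ht => ?_)
  rw [slope_def_field, ha]
  exact div_nonneg (by linarith [hpos t ht]) (by linarith [ht.1])

namespace ContinuousMap

theorem hasDerivWithinAt_lineExtend_fst {Z U : Type*} [NormedAddCommGroup Z] [NormedSpace ℝ Z]
    [CompleteSpace Z] [TopologicalSpace U] (G : C(Z × U, Z)) (a : Z) (γ : C(I, Z × U))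
    (hγ : ∀ s, (γ s).1 = a + volterra (G.comp γ) s) {t : ℝ} (ht : t ∈ Icc (0 : ℝ) 1) :
    HasDerivWithinAt (fun r => (γ.lineExtend r).1) (G (γ.lineExtend t)) (Icc 0 1) t := by
  have hval : ∀ r ∈ Icc (0 : ℝ) 1,
      (γ.lineExtend r).1 = a + ∫ s in (0 : ℝ)..r, (G.comp γ).lineExtend s := fun r hr => by
    rw [lineExtend_of_mem γ hr]
    exact hγ ⟨r, hr⟩
  exact (((G.comp γ).hasDerivAt_integral_lineExtend t).const_add a).hasDerivWithinAt.congr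
    hval (hval t ht)

end ContinuousMap

/-- Undoing a change of the time scale in a controlled differential equation. -/
theorem exists_time_rescaling {E K : Type*} [NormedAddCommGroup E] [NormedSpace ℝ E]
    [TopologicalSpace K] {f : E → K → ℝ → E} {L : E → K → ℝ → ℝ}
    (hL : Continuous fun q : E × K × ℝ => L q.1 q.2.1 q.2.2)
    {y : ℝ → E} {v : ℝ → K} {w T : ℝ → ℝ} {ε : ℝ} (hε : 0 < ε) (hw : ∀ s, ε ≤ w s)
    (hy : Continuous y) (hv : Continuous v) (hwc : Continuous w)
    (hT : ∀ s ∈ Icc (0 : ℝ) 1, HasDerivWithinAt T (w s) (Icc 0 1) s)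
    (hyd : ∀ s ∈ Icc (0 : ℝ) 1,
      HasDerivWithinAt y (w s • f (y s) (v s) (T s)) (Icc 0 1) s) :
    ∃ S : ℝ → ℝ, Continuous S ∧ StrictMono S ∧ S (T 0) = 0 ∧ S (T 1) = 1 ∧
      (∀ t ∈ Icc (T 0) (T 1), T (S t) = t) ∧
      (∀ t ∈ Icc (T 0) (T 1),
        HasDerivWithinAt (fun t => y (S t)) (f (y (S t)) (v (S t)) t) (Icc (T 0) (T 1)) t) ∧
      ∫ t in T 0..T 1, L (y (S t)) (v (S t)) t
        = ∫ s in (0 : ℝ)..1, w s * L (y s) (v s) (T s) := by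
  -- `T` is controlled only on `[0, 1]`. The primitive `R` agrees with it there and has speed at
  -- least `ε` on the whole line, which provides a global inverse without boundary cases.
  set R : ℝ → ℝ := fun s => T 0 + ∫ r in (0 : ℝ)..s, w r with hR
  have hRd : ∀ s, HasDerivAt R (w s) s := fun s =>
    (hwc.integral_hasStrictDerivAt 0 s).hasDerivAt.const_add (T 0)
  have hRT : ∀ s ∈ Icc (0 : ℝ) 1, R s = T s := fun s hs => by
    have := intervalIntegral.integral_eq_sub_of_hasDerivWithinAt_Icc hs.1
      (fun r hr => (hT r ⟨hr.1, hr.2.trans hs.2⟩).mono (Icc_subset_Icc_right hs.2))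
      hwc.continuousOn
    simp only [hR, this, add_sub_cancel]
  obtain ⟨S, hSm, hSR, hRS, hSd⟩ := exists_hasDerivAt_inverse_of_le_deriv hε hw hRd
  have hSc : Continuous S := continuous_iff_continuousAt.2 fun t => (hSd t).continuousAt
  have hz : (0 : ℝ) ∈ Icc (0 : ℝ) 1 := left_mem_Icc.2 zero_le_one
  have ho : (1 : ℝ) ∈ Icc (0 : ℝ) 1 := right_mem_Icc.2 zero_le_one
  have hS0 : S (T 0) = 0 := by rw [← hRT 0 hz, hSR]
  have hS1 : S (T 1) = 1 := by rw [← hRT 1 ho, hSR]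
  have hmem : MapsTo S (Icc (T 0) (T 1)) (Icc 0 1) := fun t ht => by
    rw [← hS0, ← hS1]
    exact ⟨hSm.monotone ht.1, hSm.monotone ht.2⟩
  have hTS : ∀ t ∈ Icc (T 0) (T 1), T (S t) = t := fun t ht => by
    rw [← hRT _ (hmem ht), hRS]
  refine ⟨S, hSc, hSm, hS0, hS1, hTS, fun t ht => ?_, ?_⟩
  · have h1 := (hyd (S t) (hmem ht)).scomp t (hSd t).hasDerivWithinAt hmem
    rw [smul_smul, inv_mul_cancel₀ (hε.trans_le (hw _)).ne', one_smul, hTS t ht] at h1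
    exact h1
  · have h1 := intervalIntegral.integral_comp_mul_deriv (a := 0) (b := 1) (f := R) (f' := w)
      (g := fun t => L (y (S t)) (v (S t)) t) (fun s _ => hRd s) hwc.continuousOn
      (hL.comp ((hy.comp hSc).prodMk ((hv.comp hSc).prodMk continuous_id)))
    rw [hRT 0 hz, hRT 1 ho] at h1
    rw [← h1]
    refine intervalIntegral.integral_congr fun s hs => ?_
    rw [uIcc_of_le zero_le_one] at hs
    simp only [Function.comp_apply, hSR]
    rw [hRT s hs, mul_comm]

/-! ### The problem with dilated time and its return to original time -/

namespace SwitchedProblem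

/-- States `(y₁, t₁, y₂, t₂, c)` of the problem with dilated time: the state and the time in both
phases, and the accumulated cost. -/
abbrev DilatedState (n : ℕ) : Type :=
  EuclideanSpace ℝ (Fin n) × ℝ × EuclideanSpace ℝ (Fin n) × ℝ × ℝ

/-- Controls `(v₁, w₁, v₂, w₂)` of the problem with dilated time: the control and the speed of time
in both phases. -/
abbrev DilatedControl (k : ℕ) : Type :=
  EuclideanSpace ℝ (Fin k) × ℝ × EuclideanSpace ℝ (Fin k) × ℝ

variable {n k : ℕ}

/-- Dynamics of the problem with dilated time. -/
noncomputable def dilatedField (P : SwitchedProblem n k)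
    (p : DilatedState n × DilatedControl k) : DilatedState n :=
  (p.2.2.1 • P.f₁ p.1.1 p.2.1 p.1.2.1, p.2.2.1,
    p.2.2.2.2 • P.f₂ p.1.2.2.1 p.2.2.2.1 p.1.2.2.2.1, p.2.2.2.2,
    p.2.2.1 * P.L₁ p.1.1 p.2.1 p.1.2.1 + p.2.2.2.2 * P.L₂ p.1.2.2.1 p.2.2.2.1 p.1.2.2.2.1)

theorem IsSmooth.contDiff_dilatedField {P : SwitchedProblem n k} (hP : P.IsSmooth) :
    ContDiff ℝ 1 P.dilatedField := by
  have a₁ : ContDiff ℝ 1 fun p : DilatedState n × DilatedControl k => (p.1.1, p.2.1, p.1.2.1) := by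
    fun_prop
  have a₂ : ContDiff ℝ 1 fun p : DilatedState n × DilatedControl k =>
      (p.1.2.2.1, p.2.2.2.1, p.1.2.2.2.1) := by fun_prop
  have w₁ : ContDiff ℝ 1 fun p : DilatedState n × DilatedControl k => p.2.2.1 := by fun_prop
  have w₂ : ContDiff ℝ 1 fun p : DilatedState n × DilatedControl k => p.2.2.2.2 := by fun_prop
  exact (w₁.smul (hP.f₁.comp a₁)).prodMk (w₁.prodMk ((w₂.smul (hP.f₂.comp a₂)).prodMk
    (w₂.prodMk ((w₁.mul (hP.L₁.comp a₁)).add (w₂.mul (hP.L₂.comp a₂))))))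

/-- Dynamics of the problem with dilated time, as a continuous map. -/
noncomputable def IsSmooth.dilatedMap {P : SwitchedProblem n k} (hP : P.IsSmooth) :
    C(DilatedState n × DilatedControl k, DilatedState n) :=
  ⟨P.dilatedField, hP.contDiff_dilatedField.continuous⟩

theorem exists_pos_le_lineExtend {X : Type*} [TopologicalSpace X] {h : X → ℝ} (hh : Continuous h)
    (γ : C(I, X)) (hpos : ∀ s, 0 < h (γ s)) : ∃ ε > 0, ∀ s, ε ≤ h (γ.lineExtend s) := by
  obtain ⟨s₀, -, hs₀⟩ := isCompact_univ.exists_isMinOn univ_nonempty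
    (hh.comp γ.continuous).continuousOn
  exact ⟨h (γ s₀), hpos s₀, fun s => hs₀ (mem_univ _)⟩

/-- A process of the problem with dilated time gives an admissible process of the same cost. -/
theorem exists_isAdmissible_of_dilated {P : SwitchedProblem n k} (hP : P.IsSmooth)
    (θ : EuclideanSpace ℝ (Fin n) × ℝ) (γ : C(I, DilatedState n × DilatedControl k))
    (hγ : ∀ t ∈ Icc (0 : ℝ) 1, HasDerivWithinAt (fun r => (γ.lineExtend r).1)
      (P.dilatedField (γ.lineExtend t)) (Icc 0 1) t)
    (h₀ : (γ 0).1 = (P.x₀, P.t₀, θ.1, θ.2, 0))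
    (hx₁ : (γ 1).1.1 = θ.1) (ht₁ : (γ 1).1.2.1 = θ.2) (hg : P.g θ.1 θ.2 = 0)
    (hW : (γ 1).1.2.2.1 - P.x_f ∈ P.W) (ht₂ : (γ 1).1.2.2.2.1 = P.t_f)
    (hw₁ : ∀ s, 0 < (γ s).2.2.1) (hw₂ : ∀ s, 0 < (γ s).2.2.2.2)
    (hneg : ∀ s ∈ Ico (0 : ℝ) 1, P.g (γ.lineExtend s).1.1 (γ.lineExtend s).1.2.1 < 0)
    (hpos : ∀ s ∈ Ioc (0 : ℝ) 1,
      0 < P.g (γ.lineExtend s).1.2.2.1 (γ.lineExtend s).1.2.2.2.1) :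
    ∃ x u₁ u₂ τ, P.IsAdmissible x u₁ u₂ τ ∧
      P.cost x u₁ u₂ τ = P.φ (γ 1).1.2.2.1 + (γ 1).1.2.2.2.2 := by
  have hc := γ.continuous_lineExtend
  have e0 := γ.lineExtend_zero
  have e1 := γ.lineExtend_one
  obtain ⟨ε₁, hε₁, hw₁'⟩ := exists_pos_le_lineExtend
    (h := fun p : DilatedState n × DilatedControl k => p.2.2.1) (by fun_prop) γ hw₁
  obtain ⟨ε₂, hε₂, hw₂'⟩ := exists_pos_le_lineExtend
    (h := fun p : DilatedState n × DilatedControl k => p.2.2.2.2) (by fun_prop) γ hw₂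
  have hfst : ∀ {E F : Type} [NormedAddCommGroup E] [NormedSpace ℝ E] [NormedAddCommGroup F]
      [NormedSpace ℝ F] {z : ℝ → E × F} {z' : E × F} {t : ℝ},
      HasDerivWithinAt z z' (Icc 0 1) t →
      HasDerivWithinAt (fun r => (z r).1) z'.1 (Icc 0 1) t ∧
        HasDerivWithinAt (fun r => (z r).2) z'.2 (Icc 0 1) t := fun {E F} _ _ _ _ _ _ t h =>
    ⟨(ContinuousLinearMap.fst ℝ E F).hasFDerivAt.comp_hasDerivWithinAt t h,
      (ContinuousLinearMap.snd ℝ E F).hasFDerivAt.comp_hasDerivWithinAt t h⟩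
  obtain ⟨S₁, hS₁c, hS₁m, hS₁0, hS₁1, hTS₁, hyS₁, hI₁⟩ := exists_time_rescaling
    (f := P.f₁) (L := P.L₁) hP.L₁.continuous
    (y := fun s => (γ.lineExtend s).1.1) (v := fun s => (γ.lineExtend s).2.1)
    (w := fun s => (γ.lineExtend s).2.2.1) (T := fun s => (γ.lineExtend s).1.2.1)
    hε₁ hw₁' (by fun_prop) (by fun_prop) (by fun_prop)
    (fun s hs => (hfst (hfst (hγ s hs)).2).1) (fun s hs => (hfst (hγ s hs)).1)
  obtain ⟨S₂, hS₂c, hS₂m, hS₂0, hS₂1, hTS₂, hyS₂, hI₂⟩ := exists_time_rescaling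
    (f := P.f₂) (L := P.L₂) hP.L₂.continuous
    (y := fun s => (γ.lineExtend s).1.2.2.1) (v := fun s => (γ.lineExtend s).2.2.2.1)
    (w := fun s => (γ.lineExtend s).2.2.2.2) (T := fun s => (γ.lineExtend s).1.2.2.2.1)
    hε₂ hw₂' (by fun_prop) (by fun_prop) (by fun_prop)
    (fun s hs => (hfst (hfst (hfst (hfst (hγ s hs)).2).2).2).1)
    (fun s hs => (hfst (hfst (hfst (hγ s hs)).2).2).1)
  have hIc := intervalIntegral.integral_eq_sub_of_hasDerivWithinAt_Icc zero_le_one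
    (fun s hs => (hfst (hfst (hfst (hfst (hγ s hs)).2).2).2).2)
    (by
      have := hP.contDiff_dilatedField.continuous.comp hc
      exact this.snd.snd.snd.snd.continuousOn)
  simp only [e0, e1, h₀, ht₁, ht₂] at hS₁0 hS₁1 hTS₁ hyS₁ hI₁ hS₂0 hS₂1 hTS₂ hyS₂ hI₂ hIc
  have hlt₁ : P.t₀ < θ.2 := hS₁m.lt_iff_lt.1 (by rw [hS₁0, hS₁1]; exact zero_lt_one)
  have hlt₂ : θ.2 < P.t_f := hS₂m.lt_iff_lt.1 (by rw [hS₂0, hS₂1]; exact zero_lt_one)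
  set x : ℝ → EuclideanSpace ℝ (Fin n) := fun t =>
    if t ≤ θ.2 then (γ.lineExtend (S₁ t)).1.1 else (γ.lineExtend (S₂ t)).1.2.2.1
  have hx1 : ∀ t ≤ θ.2, x t = (γ.lineExtend (S₁ t)).1.1 := fun t ht => if_pos ht
  -- Both branches take the value `θ.1` at the seam, so the glued state satisfies each differential
  -- equation up to and including the crossing.
  have hx2 : ∀ t, θ.2 ≤ t → x t = (γ.lineExtend (S₂ t)).1.2.2.1 := fun t ht => by
    rcases ht.eq_or_lt with rfl | ht
    · rw [hx1 _ le_rfl, hS₁1, hS₂0, e1, e0, hx₁, h₀]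
    · exact if_neg (not_le.2 ht)
  refine ⟨x, fun t => (γ.lineExtend (S₁ t)).2.1, fun t => (γ.lineExtend (S₂ t)).2.2.2.1, θ.2,
    ⟨⟨hlt₁, hlt₂⟩, ?_, ?_, ?_, ?_, ?_, ?_, ?_, ?_, ?_⟩, ?_⟩
  · rw [hx1 _ hlt₁.le, hS₁0, e0, h₀]
  · rw [hx2 _ hlt₂.le, hS₂1, e1]
    exact hW
  · exact (by fun_prop : Continuous fun t => (γ.lineExtend (S₁ t)).2.1).continuousOn
  · exact (by fun_prop : Continuous fun t => (γ.lineExtend (S₂ t)).2.2.2.1).continuousOn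
  · intro t ht
    rw [hx1 t ht.2]
    exact (hyS₁ t ht).congr (fun r hr => hx1 r hr.2) (hx1 t ht.2)
  · intro t ht
    rw [hx2 t ht.1]
    exact (hyS₂ t ht).congr (fun r hr => hx2 r hr.1) (hx2 t ht.1)
  · intro t ht
    have h1 := hneg (S₁ t) ⟨hS₁0 ▸ hS₁m.monotone ht.1, hS₁1 ▸ hS₁m ht.2⟩
    rwa [hTS₁ t ⟨ht.1, ht.2.le⟩, ← hx1 t ht.2.le] at h1
  · rw [hx1 _ le_rfl, hS₁1, e1, hx₁, hg]
  · intro t ht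
    have h1 := hpos (S₂ t) ⟨hS₂0 ▸ hS₂m ht.1, hS₂1 ▸ hS₂m.monotone ht.2⟩
    rwa [hTS₂ t ⟨ht.1.le, ht.2⟩, ← hx2 t ht.1.le] at h1
  · have hc₁ : ∫ t in P.t₀..θ.2, P.L₁ (x t) (γ.lineExtend (S₁ t)).2.1 t
        = ∫ s in (0 : ℝ)..1, (γ.lineExtend s).2.2.1 *
          P.L₁ (γ.lineExtend s).1.1 (γ.lineExtend s).2.1 (γ.lineExtend s).1.2.1 := by
      rw [← hI₁]
      refine intervalIntegral.integral_congr fun t ht => ?_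
      rw [uIcc_of_le hlt₁.le] at ht
      simp only [hx1 t ht.2]
    have hc₂ : ∫ t in θ.2..P.t_f, P.L₂ (x t) (γ.lineExtend (S₂ t)).2.2.2.1 t
        = ∫ s in (0 : ℝ)..1, (γ.lineExtend s).2.2.2.2 *
          P.L₂ (γ.lineExtend s).1.2.2.1 (γ.lineExtend s).2.2.2.1 (γ.lineExtend s).1.2.2.2.1 := by
      rw [← hI₂]
      refine intervalIntegral.integral_congr fun t ht => ?_
      rw [uIcc_of_le hlt₂.le] at ht
      simp only [hx2 t ht.1]
    have hL₁ : Continuous fun s => (γ.lineExtend s).2.2.1 *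
        P.L₁ (γ.lineExtend s).1.1 (γ.lineExtend s).2.1 (γ.lineExtend s).1.2.1 :=
      (by fun_prop : Continuous fun s => (γ.lineExtend s).2.2.1).mul
        (hP.L₁.continuous.comp (by fun_prop : Continuous fun s =>
          ((γ.lineExtend s).1.1, (γ.lineExtend s).2.1, (γ.lineExtend s).1.2.1)))
    have hL₂ : Continuous fun s => (γ.lineExtend s).2.2.2.2 *
        P.L₂ (γ.lineExtend s).1.2.2.1 (γ.lineExtend s).2.2.2.1 (γ.lineExtend s).1.2.2.2.1 :=
      (by fun_prop : Continuous fun s => (γ.lineExtend s).2.2.2.2).mul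
        (hP.L₂.continuous.comp (by fun_prop : Continuous fun s =>
          ((γ.lineExtend s).1.2.2.1, (γ.lineExtend s).2.2.2.1, (γ.lineExtend s).1.2.2.2.1)))
    rw [cost, hx2 _ hlt₂.le, hS₂1, e1, hc₁, hc₂, add_assoc, ← intervalIntegral.integral_add
      (hL₁.intervalIntegrable _ _) (hL₂.intervalIntegrable _ _)]
    rw [sub_zero] at hIc
    rw [← hIc]
    rfl

end SwitchedProblem

namespace ContinuousMap

theorem eq_add_volterra_of_hasDerivWithinAt {Z : Type*} [NormedAddCommGroup Z] [NormedSpace ℝ Z]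
    [CompleteSpace Z] {z : ℝ → Z} {w : C(I, Z)}
    (hz : ∀ t ∈ Icc (0 : ℝ) 1, HasDerivWithinAt z (w.lineExtend t) (Icc 0 1) t) (s : I) :
    z s = z 0 + volterra w s := by
  have := intervalIntegral.integral_eq_sub_of_hasDerivWithinAt_Icc s.2.1
    (fun r hr => (hz r ⟨hr.1, hr.2.trans s.2.2⟩).mono (Icc_subset_Icc_right s.2.2))
    w.continuous_lineExtend.continuousOn
  rw [volterra_apply, this, add_sub_cancel]

end ContinuousMap

/-! ### Crossing speed and dilation of an admissible process -/

namespace SwitchedProblem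

variable {n k : ℕ} {P : SwitchedProblem n k} {x : ℝ → EuclideanSpace ℝ (Fin n)}
  {u₁ u₂ : ℝ → EuclideanSpace ℝ (Fin k)} {τ : ℝ}

theorem IsSmooth.fderiv_interface (hP : P.IsSmooth) (y : EuclideanSpace ℝ (Fin n)) (t : ℝ)
    (v : EuclideanSpace ℝ (Fin n)) (r : ℝ) :
    fderiv ℝ (fun q : EuclideanSpace ℝ (Fin n) × ℝ => P.g q.1 q.2) (y, t) (v, r)
      = inner ℝ (P.normal y t) v + P.timeSlope y t * r := by
  have hg := ((hP.g.differentiable one_ne_zero) (y, t)).hasFDerivAt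
  have h1 : HasFDerivAt (fun z => P.g z t) _ y :=
    hg.comp (f := fun z => (z, t)) y ((hasFDerivAt_id y).prodMk (hasFDerivAt_const t y))
  have h2 : HasDerivAt (fun s => P.g y s) _ t :=
    hg.comp_hasDerivAt (f := fun s => (y, s)) t ((hasDerivAt_const t y).prodMk (hasDerivAt_id t))
  have h3 : (v, r) = (v, (0 : ℝ)) + r • ((0 : EuclideanSpace ℝ (Fin n)), (1 : ℝ)) := by simp
  rw [h3, map_add, map_smul, normal, timeSlope, inner_gradient_left, h1.fderiv, h2.deriv,
    smul_eq_mul, mul_comm]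
  rfl

theorem IsAdmissible.continuousOn_state₁ (h : P.IsAdmissible x u₁ u₂ τ) :
    ContinuousOn x (Icc P.t₀ τ) := fun t ht => (h.dynamics₁ t ht).continuousWithinAt

theorem IsAdmissible.continuousOn_state₂ (h : P.IsAdmissible x u₁ u₂ τ) :
    ContinuousOn x (Icc τ P.t_f) := fun t ht => (h.dynamics₂ t ht).continuousWithinAt

/-- At a transversal crossing, the interface function increases in both phases. -/
theorem IsAdmissible.crossing_speed_pos (hP : P.IsSmooth) (h : P.IsAdmissible x u₁ u₂ τ)
    (htrans : P.IsTransversal x u₁ u₂ τ) :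
    0 < inner ℝ (P.normal (x τ) τ) (P.f₁ (x τ) (u₁ τ) τ) + P.timeSlope (x τ) τ ∧
      0 < inner ℝ (P.normal (x τ) τ) (P.f₂ (x τ) (u₂ τ) τ) + P.timeSlope (x τ) τ := by
  have hg := ((hP.g.differentiable one_ne_zero) (x τ, τ)).hasFDerivAt
  have hd : ∀ {v : EuclideanSpace ℝ (Fin n)} {s : Set ℝ}, HasDerivWithinAt x v s τ →
      HasDerivWithinAt (fun t => P.g (x t) t)
        (inner ℝ (P.normal (x τ) τ) v + P.timeSlope (x τ) τ) s τ := fun {v s} hv => by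
    have h1 := hg.comp_hasDerivWithinAt (f := fun t => (x t, t)) τ
      (hv.prodMk (hasDerivWithinAt_id τ s))
    rwa [hP.fderiv_interface, mul_one] at h1
  -- The signs of `g` before and after the crossing only give nonnegative one-sided rates;
  -- transversality excludes zero.
  exact ⟨((hd (h.dynamics₁ τ (right_mem_Icc.2 h.mem_Ioo.1.le))).nonneg_of_neg_of_eq_zero
      h.mem_Ioo.1 h.before h.crossing).lt_of_ne' htrans.1,
    ((hd (h.dynamics₂ τ (left_mem_Icc.2 h.mem_Ioo.2.le))).nonneg_of_eq_zero_of_pos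
      h.mem_Ioo.2 h.after h.crossing).lt_of_ne' htrans.2⟩

theorem add_mul_mem_Icc {a b s : ℝ} (hab : a ≤ b) (hs : s ∈ Icc (0 : ℝ) 1) :
    a + (b - a) * s ∈ Icc a b :=
  ⟨by nlinarith [hs.1, mul_nonneg (sub_nonneg.2 hab) hs.1],
    by nlinarith [mul_le_mul_of_nonneg_left hs.2 (sub_nonneg.2 hab)]⟩

/-- An admissible process as a process of the problem with dilated time. -/
theorem IsAdmissible.exists_dilated (hP : P.IsSmooth) (h : P.IsAdmissible x u₁ u₂ τ) :
    ∃ γ : C(I, DilatedState n × DilatedControl k),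
      (∀ s : I, ∃ c, γ s =
        ((x (P.t₀ + (τ - P.t₀) * s), P.t₀ + (τ - P.t₀) * s,
          x (τ + (P.t_f - τ) * s), τ + (P.t_f - τ) * s, c),
          u₁ (P.t₀ + (τ - P.t₀) * s), τ - P.t₀, u₂ (τ + (P.t_f - τ) * s), P.t_f - τ)) ∧
      (∀ s, (γ s).1 = (P.x₀, P.t₀, x τ, τ, 0)
        + ContinuousMap.volterra (hP.dilatedMap.comp γ) s) ∧
      P.φ (γ 1).1.2.2.1 + (γ 1).1.2.2.2.2 = P.cost x u₁ u₂ τ := by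
  have hm₁ : MapsTo (fun s : ℝ => P.t₀ + (τ - P.t₀) * s) (Icc 0 1) (Icc P.t₀ τ) :=
    fun s hs => add_mul_mem_Icc h.mem_Ioo.1.le hs
  have hm₂ : MapsTo (fun s : ℝ => τ + (P.t_f - τ) * s) (Icc 0 1) (Icc τ P.t_f) :=
    fun s hs => add_mul_mem_Icc h.mem_Ioo.2.le hs
  have hc₁ : Continuous fun s : I => P.t₀ + (τ - P.t₀) * (s : ℝ) := by fun_prop
  have hc₂ : Continuous fun s : I => τ + (P.t_f - τ) * (s : ℝ) := by fun_prop
  have hx₁ := h.continuousOn_state₁.comp_continuous hc₁ fun s => hm₁ s.2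
  have hx₂ := h.continuousOn_state₂.comp_continuous hc₂ fun s => hm₂ s.2
  have hu₁ := h.continuousOn₁.comp_continuous hc₁ fun s => hm₁ s.2
  have hu₂ := h.continuousOn₂.comp_continuous hc₂ fun s => hm₂ s.2
  -- Each clock runs at constant speed, the length of its phase; `ℓ` is the resulting rate of the
  -- accumulated cost of both phases.
  set ℓ : C(I, ℝ) := ⟨fun s : I =>
    (τ - P.t₀) * P.L₁ (x (P.t₀ + (τ - P.t₀) * s)) (u₁ (P.t₀ + (τ - P.t₀) * s))
        (P.t₀ + (τ - P.t₀) * s)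
      + (P.t_f - τ) * P.L₂ (x (τ + (P.t_f - τ) * s)) (u₂ (τ + (P.t_f - τ) * s))
        (τ + (P.t_f - τ) * s),
    ((continuous_const.mul (hP.L₁.continuous.comp (hx₁.prodMk (hu₁.prodMk hc₁)))).add
      (continuous_const.mul (hP.L₂.continuous.comp (hx₂.prodMk (hu₂.prodMk hc₂)))))⟩
  set γ : C(I, DilatedState n × DilatedControl k) := ⟨fun s : I =>
    ((x (P.t₀ + (τ - P.t₀) * s), P.t₀ + (τ - P.t₀) * s,
      x (τ + (P.t_f - τ) * s), τ + (P.t_f - τ) * s, ContinuousMap.volterra ℓ s),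
      u₁ (P.t₀ + (τ - P.t₀) * s), τ - P.t₀, u₂ (τ + (P.t_f - τ) * s), P.t_f - τ),
    (hx₁.prodMk (hc₁.prodMk (hx₂.prodMk (hc₂.prodMk
      (ContinuousMap.volterra ℓ).continuous)))).prodMk
      (hu₁.prodMk (continuous_const.prodMk (hu₂.prodMk continuous_const)))⟩ with hγ
  refine ⟨γ, fun s => ⟨_, rfl⟩, fun s => ?_, ?_⟩
  · have hd : ∀ t ∈ Icc (0 : ℝ) 1, HasDerivWithinAt
        (fun r : ℝ => ((x (P.t₀ + (τ - P.t₀) * r), P.t₀ + (τ - P.t₀) * r,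
          x (τ + (P.t_f - τ) * r), τ + (P.t_f - τ) * r,
          ∫ s in (0 : ℝ)..r, ℓ.lineExtend s) : DilatedState n))
        ((hP.dilatedMap.comp γ).lineExtend t) (Icc 0 1) t := fun t ht => by
      have ha : ∀ a b : ℝ, HasDerivWithinAt (fun r : ℝ => a + b * r) b (Icc 0 1) t := fun a b => by
        simpa using ((hasDerivWithinAt_id t (Icc (0 : ℝ) 1)).const_mul b).const_add a
      have h1 := (h.dynamics₁ _ (hm₁ ht)).scomp t (ha _ _) hm₁
      have h2 := (h.dynamics₂ _ (hm₂ ht)).scomp t (ha _ _) hm₂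
      have h3 := (ℓ.hasDerivAt_integral_lineExtend t).hasDerivWithinAt (s := Icc 0 1)
      rw [ContinuousMap.lineExtend_of_mem _ ht] at h3 ⊢
      exact h1.prodMk ((ha _ _).prodMk (h2.prodMk ((ha _ _).prodMk h3)))
    have h1 := ContinuousMap.eq_add_volterra_of_hasDerivWithinAt hd s
    have h2 : (γ s).1 = _ := h1
    rw [h2]
    simp [h.initial]
  · have h1 := intervalIntegral.mul_integral_comp_add_mul (a := 0) (b := 1)
      (f := fun t => P.L₁ (x t) (u₁ t) t) (τ - P.t₀) P.t₀
    have h2 := intervalIntegral.mul_integral_comp_add_mul (a := 0) (b := 1)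
      (f := fun t => P.L₂ (x t) (u₂ t) t) (P.t_f - τ) τ
    simp only [mul_zero, mul_one, add_zero, add_sub_cancel] at h1 h2
    have hi : ∀ {f : ℝ → ℝ}, (Continuous fun s : I => f s) →
        IntervalIntegrable f volume 0 1 := fun {f} hf =>
      (continuousOn_iff_continuous_domRestrict.2 hf).intervalIntegrable_of_Icc zero_le_one
    have hi₁ : IntervalIntegrable (fun s : ℝ => (τ - P.t₀) *
        P.L₁ (x (P.t₀ + (τ - P.t₀) * s)) (u₁ (P.t₀ + (τ - P.t₀) * s)) (P.t₀ + (τ - P.t₀) * s))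
        volume 0 1 :=
      hi (continuous_const.mul (hP.L₁.continuous.comp (hx₁.prodMk (hu₁.prodMk hc₁))))
    have hi₂ : IntervalIntegrable (fun s : ℝ => (P.t_f - τ) *
        P.L₂ (x (τ + (P.t_f - τ) * s)) (u₂ (τ + (P.t_f - τ) * s)) (τ + (P.t_f - τ) * s))
        volume 0 1 :=
      hi (continuous_const.mul (hP.L₂.continuous.comp (hx₂.prodMk (hu₂.prodMk hc₂))))
    have h3 : (γ 1).1.2.2.2.2 = (∫ s in (0 : ℝ)..1, (τ - P.t₀) *
          P.L₁ (x (P.t₀ + (τ - P.t₀) * s)) (u₁ (P.t₀ + (τ - P.t₀) * s)) (P.t₀ + (τ - P.t₀) * s))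
        + ∫ s in (0 : ℝ)..1, (P.t_f - τ) *
          P.L₂ (x (τ + (P.t_f - τ) * s)) (u₂ (τ + (P.t_f - τ) * s)) (τ + (P.t_f - τ) * s) := by
      rw [← intervalIntegral.integral_add hi₁ hi₂]
      refine intervalIntegral.integral_congr fun s hs => ?_
      rw [uIcc_of_le (show (0 : ℝ) ≤ ((1 : I) : ℝ) from zero_le_one)] at hs
      exact ContinuousMap.lineExtend_of_mem ℓ hs
    have h4 : (γ 1).1.2.2.1 = x P.t_f := by simp [hγ]
    rw [h3, h4, intervalIntegral.integral_const_mul, intervalIntegral.integral_const_mul, h1, h2,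
      cost, add_assoc]

end SwitchedProblem

/-! ### Constraints of the dilated problem and local optimality -/

namespace SwitchedProblem

variable {n k : ℕ} {P : SwitchedProblem n k} {x : ℝ → EuclideanSpace ℝ (Fin n)}
  {u₁ u₂ : ℝ → EuclideanSpace ℝ (Fin k)} {τ : ℝ}

/-- The initial state of the problem with dilated time depends on the state and the time of the
crossing through this map. -/
noncomputable def crossingEmbedding (n : ℕ) : EuclideanSpace ℝ (Fin n) × ℝ →L[ℝ] DilatedState n :=
  (0 : EuclideanSpace ℝ (Fin n) × ℝ →L[ℝ] EuclideanSpace ℝ (Fin n)).prod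
    ((0 : EuclideanSpace ℝ (Fin n) × ℝ →L[ℝ] ℝ).prod
      ((ContinuousLinearMap.fst ℝ (EuclideanSpace ℝ (Fin n)) ℝ).prod
        ((ContinuousLinearMap.snd ℝ (EuclideanSpace ℝ (Fin n)) ℝ).prod 0)))

theorem crossingEmbedding_apply (θ : EuclideanSpace ℝ (Fin n) × ℝ) :
    crossingEmbedding n θ = (0, 0, θ.1, θ.2, 0) := rfl

/-- Values of the constraints of the problem with dilated time. -/
abbrev DilatedConstraint (P : SwitchedProblem n k) : Type :=
  EuclideanSpace ℝ (Fin n) × ℝ × ℝ × P.Wᗮ × ℝ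

/-- Constraints of the problem with dilated time. -/
noncomputable def dilatedConstraint (P : SwitchedProblem n k)
    (q : (EuclideanSpace ℝ (Fin n) × ℝ) × DilatedState n) : P.DilatedConstraint :=
  (q.1.1 - q.2.1, q.1.2 - q.2.2.1, P.g q.2.1 q.2.2.1,
    P.Wᗮ.orthogonalProjectionOnto (q.2.2.2.1 - P.x_f), q.2.2.2.2.1 - P.t_f)

/-- Performance index of the problem with dilated time. -/
def dilatedCost (P : SwitchedProblem n k)
    (q : (EuclideanSpace ℝ (Fin n) × ℝ) × DilatedState n) : ℝ :=
  P.φ q.2.2.2.1 + q.2.2.2.2.2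

theorem IsSmooth.contDiff_dilatedConstraint (hP : P.IsSmooth) :
    ContDiff ℝ 1 P.dilatedConstraint := by
  have hg : ContDiff ℝ 1 fun q : (EuclideanSpace ℝ (Fin n) × ℝ) × DilatedState n =>
      P.g q.2.1 q.2.2.1 := hP.g.comp (by fun_prop :
    ContDiff ℝ 1 fun q : (EuclideanSpace ℝ (Fin n) × ℝ) × DilatedState n => (q.2.1, q.2.2.1))
  unfold dilatedConstraint
  fun_prop

theorem IsSmooth.contDiff_dilatedCost (hP : P.IsSmooth) : ContDiff ℝ 1 P.dilatedCost := by
  have hφ := hP.φ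
  unfold dilatedCost
  fun_prop

/-- This turns the terminal condition into an equation with values in `Wᗮ`. Its multiplier does not
see variations in `W`, which is how the transversality condition at the final time arises. -/
theorem orthogonalProjectionOnto_orthogonal_eq_zero_iff {v : EuclideanSpace ℝ (Fin n)} :
    P.Wᗮ.orthogonalProjectionOnto v = 0 ↔ v ∈ P.W := by
  rw [Submodule.orthogonalProjectionOnto_eq_zero_iff, Submodule.orthogonal_orthogonal]

theorem dilatedConstraint_eq_zero_iff
    (q : (EuclideanSpace ℝ (Fin n) × ℝ) × DilatedState n) :
    P.dilatedConstraint q = 0 ↔ q.2.1 = q.1.1 ∧ q.2.2.1 = q.1.2 ∧ P.g q.2.1 q.2.2.1 = 0 ∧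
      q.2.2.2.1 - P.x_f ∈ P.W ∧ q.2.2.2.2.1 = P.t_f := by
  simp only [dilatedConstraint, Prod.mk_eq_zero, orthogonalProjectionOnto_orthogonal_eq_zero_iff,
    sub_eq_zero, eq_comm (a := q.1.1), eq_comm (a := q.1.2)]

/-- Near an admissible process with transversal crossing, processes of the problem with dilated time
which satisfy the constraints give admissible processes. -/
theorem IsAdmissible.eventually_exists_isAdmissible (hP : P.IsSmooth)
    (h : P.IsAdmissible x u₁ u₂ τ) (htrans : P.IsTransversal x u₁ u₂ τ)
    {γ₀ : C(I, DilatedState n × DilatedControl k)}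
    (hγ₀ : ∀ s : I, ∃ c, γ₀ s =
        ((x (P.t₀ + (τ - P.t₀) * s), P.t₀ + (τ - P.t₀) * s,
          x (τ + (P.t_f - τ) * s), τ + (P.t_f - τ) * s, c),
          u₁ (P.t₀ + (τ - P.t₀) * s), τ - P.t₀, u₂ (τ + (P.t_f - τ) * s), P.t_f - τ)) :
    ∀ᶠ γ in 𝓝 γ₀, ∀ θ : EuclideanSpace ℝ (Fin n) × ℝ,
      (∀ s, (γ s).1 = (P.x₀, P.t₀, 0, 0, 0) + crossingEmbedding n θ
        + ContinuousMap.volterra (hP.dilatedMap.comp γ) s) →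
      P.dilatedConstraint (θ, (γ 1).1) = 0 →
      ∃ y v₁ v₂ r, P.IsAdmissible y v₁ v₂ r ∧
        P.cost y v₁ v₂ r = P.dilatedCost (θ, (γ 1).1) := by
  set G : EuclideanSpace ℝ (Fin n) × ℝ → ℝ := fun q => P.g q.1 q.2 with hG
  have hGd : Differentiable ℝ G := hP.g.differentiable one_ne_zero
  have hGc : Continuous (fderiv ℝ G) := hP.g.continuous_fderiv one_ne_zero
  have hFc := hP.contDiff_dilatedField.continuous
  have hpos := h.crossing_speed_pos hP htrans
  have hτ₁ := sub_pos.2 h.mem_Ioo.1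
  have hτ₂ := sub_pos.2 h.mem_Ioo.2
  obtain ⟨c₀, hc₀⟩ := hγ₀ 0
  obtain ⟨c₁, hc₁⟩ := hγ₀ 1
  simp only [Set.Icc.coe_zero, mul_zero, add_zero] at hc₀
  simp only [Set.Icc.coe_one, mul_one, add_sub_cancel] at hc₁
  -- `D` is the derivative of `g` along the dilated dynamics of phase 1. At the end of the reference
  -- path it is the positive crossing speed times `τ - t₀`.
  have hev₁ := ContinuousMap.eventually_neg_of_hasDerivWithinAt
    (h := fun p : DilatedState n × DilatedControl k => G (p.1.1, p.1.2.1))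
    (D := fun p => fderiv ℝ G (p.1.1, p.1.2.1) ((P.dilatedField p).1, (P.dilatedField p).2.1))
    (hGd.continuous.comp (by fun_prop)) ((hGc.comp (by fun_prop)).clm_apply
      (hFc.fst.prodMk hFc.snd.fst)) (γ₀ := γ₀)
    (fun s hs => by
      obtain ⟨c, hc⟩ := hγ₀ s
      have hs' : (s : ℝ) < 1 := hs
      simp only [hc]
      exact h.before _ ⟨(add_mul_mem_Icc h.mem_Ioo.1.le s.2).1, by nlinarith⟩)
    (by
      simp only [hc₁, dilatedField]
      rw [hP.fderiv_interface, inner_smul_right]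
      nlinarith [mul_pos hτ₁ hpos.1])
  have hev₂ := ContinuousMap.eventually_pos_of_hasDerivWithinAt
    (h := fun p : DilatedState n × DilatedControl k => G (p.1.2.2.1, p.1.2.2.2.1))
    (D := fun p => fderiv ℝ G (p.1.2.2.1, p.1.2.2.2.1)
      ((P.dilatedField p).2.2.1, (P.dilatedField p).2.2.2.1))
    (hGd.continuous.comp (by fun_prop)) ((hGc.comp (by fun_prop)).clm_apply
      (hFc.snd.snd.fst.prodMk hFc.snd.snd.snd.fst)) (γ₀ := γ₀)
    (fun s hs => by
      obtain ⟨c, hc⟩ := hγ₀ s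
      have hs' : 0 < (s : ℝ) := hs
      simp only [hc]
      exact h.after _ ⟨by nlinarith, (add_mul_mem_Icc h.mem_Ioo.2.le s.2).2⟩)
    (by
      simp only [hc₀, dilatedField]
      rw [hP.fderiv_interface, inner_smul_right]
      nlinarith [mul_pos hτ₂ hpos.2])
  -- Positive clock speeds must persist nearby, since otherwise original time could not be
  -- recovered.
  have hopen : IsOpen {p : DilatedState n × DilatedControl k | 0 < p.2.2.1 ∧ 0 < p.2.2.2.2} :=
    IsOpen.and (isOpen_lt continuous_const (by fun_prop))
      (isOpen_lt continuous_const (by fun_prop))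
  have hev₃ : ∀ᶠ γ : C(I, DilatedState n × DilatedControl k) in 𝓝 γ₀, MapsTo γ univ
      {p : DilatedState n × DilatedControl k | 0 < p.2.2.1 ∧ 0 < p.2.2.2.2} :=
    ContinuousMap.eventually_mapsTo isCompact_univ hopen
      fun s _ => by
        obtain ⟨c, hc⟩ := hγ₀ s
        rw [hc]
        exact ⟨hτ₁, hτ₂⟩
  filter_upwards [hev₁, hev₂, hev₃] with γ hγ₁ hγ₂ hγ₃ θ hstate hcon
  rw [dilatedConstraint_eq_zero_iff] at hcon
  obtain ⟨hx₁, ht₁, hg, hW, ht₂⟩ := hcon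
  have hg' := hg
  simp only at hx₁ ht₁ hg hW ht₂
  rw [hx₁, ht₁] at hg
  have hd : ∀ t ∈ Icc (0 : ℝ) 1, HasDerivWithinAt (fun r => (γ.lineExtend r).1)
      (P.dilatedField (γ.lineExtend t)) (Icc 0 1) t := fun t ht =>
    ContinuousMap.hasDerivWithinAt_lineExtend_fst _ _ γ hstate ht
  have h₀ : (γ 0).1 = (P.x₀, P.t₀, θ.1, θ.2, 0) := by
    rw [hstate, crossingEmbedding_apply, ContinuousMap.volterra_apply]
    simp
  have hcomp : ∀ (A : DilatedState n →L[ℝ] EuclideanSpace ℝ (Fin n) × ℝ), ∀ s ∈ Icc (0 : ℝ) 1,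
      HasDerivWithinAt (fun r => G (A (γ.lineExtend r).1))
        (fderiv ℝ G (A (γ.lineExtend s).1) (A (P.dilatedField (γ.lineExtend s)))) (Icc 0 1) s :=
    fun A s hs => (hGd _).hasFDerivAt.comp_hasDerivWithinAt s
      (A.hasFDerivAt.comp_hasDerivWithinAt s (hd s hs))
  have hneg := hγ₁ (by simpa only [hG] using hg') (hcomp
    ((ContinuousLinearMap.fst ℝ _ _).prod
      ((ContinuousLinearMap.fst ℝ _ _).comp (ContinuousLinearMap.snd ℝ _ _))))
  have hpos' := hγ₂ (by simp only [hG, h₀, hg]) (hcomp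
    (((ContinuousLinearMap.fst ℝ _ _).prod
      ((ContinuousLinearMap.fst ℝ _ _).comp (ContinuousLinearMap.snd ℝ _ _))).comp
      ((ContinuousLinearMap.snd ℝ _ _).comp (ContinuousLinearMap.snd ℝ _ _))))
  exact exists_isAdmissible_of_dilated hP θ γ hd h₀ hx₁ ht₁ hg hW ht₂
    (fun s => (hγ₃ (mem_univ s)).1) (fun s => (hγ₃ (mem_univ s)).2) hneg hpos'

/-- Multipliers for the problem with dilated time along an optimal process. -/
theorem IsOptimal.exists_dilated_costate (hP : P.IsSmooth) (hopt : P.IsOptimal x u₁ u₂ τ)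
    (htrans : P.IsTransversal x u₁ u₂ τ) :
    ∃ (γ : C(I, DilatedState n × DilatedControl k)) (Λ : P.DilatedConstraint →L[ℝ] ℝ) (c : ℝ)
      (q : C(I, DilatedState n →L[ℝ] ℝ)), (c = 1 ∨ c = 0 ∧ Λ ≠ 0) ∧
      (∀ s : I, ∃ d, γ s =
        ((x (P.t₀ + (τ - P.t₀) * s), P.t₀ + (τ - P.t₀) * s,
          x (τ + (P.t_f - τ) * s), τ + (P.t_f - τ) * s, d),
          u₁ (P.t₀ + (τ - P.t₀) * s), τ - P.t₀, u₂ (τ + (P.t_f - τ) * s), P.t_f - τ)) ∧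
      (∀ t ∈ Icc (0 : ℝ) 1, HasDerivWithinAt q.lineExtend
        (-((q.lineExtend t).comp ((fderiv ℝ P.dilatedField (γ.lineExtend t)).comp
          (ContinuousLinearMap.inl ℝ _ _)))) (Icc 0 1) t) ∧
      (∀ δ, q 1 δ = Λ (fderiv ℝ P.dilatedConstraint ((x τ, τ), (γ 1).1) (0, δ))
        + c * fderiv ℝ P.dilatedCost ((x τ, τ), (γ 1).1) (0, δ)) ∧
      (∀ δ, q 0 (crossingEmbedding n δ)
        = -(Λ (fderiv ℝ P.dilatedConstraint ((x τ, τ), (γ 1).1) (δ, 0))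
          + c * fderiv ℝ P.dilatedCost ((x τ, τ), (γ 1).1) (δ, 0))) ∧
      ∀ s δ, q s (fderiv ℝ P.dilatedField (γ s) (0, δ)) = 0 := by
  obtain ⟨hadm, hextr⟩ := hopt
  obtain ⟨γ, hγ, hstate, hcost⟩ := hadm.exists_dilated hP
  have hini : ((P.x₀, P.t₀, x τ, τ, 0) : DilatedState n)
      = (P.x₀, P.t₀, 0, 0, 0) + crossingEmbedding n (x τ, τ) := by
    simp [crossingEmbedding_apply]
  rw [hini] at hstate
  have hcon : P.dilatedConstraint ((x τ, τ), (γ 1).1) = 0 := by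
    obtain ⟨d, hd⟩ := hγ 1
    simp only [Set.Icc.coe_one, mul_one, add_sub_cancel] at hd
    rw [dilatedConstraint_eq_zero_iff, hd]
    exact ⟨rfl, rfl, hadm.crossing, hadm.terminal, rfl⟩
  have hev := (hadm.eventually_exists_isAdmissible hP htrans hγ)
  have hloc : IsLocalExtrOn
      (fun p : (EuclideanSpace ℝ (Fin n) × ℝ) × C(I, DilatedState n × DilatedControl k) =>
        P.dilatedCost (p.1, (p.2 1).1))
      {p | (∀ s, (p.2 s).1 = (P.x₀, P.t₀, 0, 0, 0) + crossingEmbedding n p.1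
          + ContinuousMap.volterra (hP.dilatedMap.comp p.2) s) ∧
        P.dilatedConstraint (p.1, (p.2 1).1) = P.dilatedConstraint ((x τ, τ), (γ 1).1)}
      ((x τ, τ), γ) := by
    -- Nearness is required of the path only; every `θ` compatible with it through the state
    -- equation and the constraints is allowed.
    have hev' := (continuous_snd.tendsto
      (((x τ, τ), γ) : (EuclideanSpace ℝ (Fin n) × ℝ)
        × C(I, DilatedState n × DilatedControl k))).eventually hev
    have hbase : P.dilatedCost ((x τ, τ), (γ 1).1) = P.cost x u₁ u₂ τ := hcost
    rcases hextr with hmin | hmax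
    · left
      filter_upwards [mem_nhdsWithin_of_mem_nhds hev', self_mem_nhdsWithin] with p hp hpS
      obtain ⟨y, v₁, v₂, r, hy, hyc⟩ := hp p.1 hpS.1 (hpS.2.trans hcon)
      simp only [hbase]
      exact (hmin y v₁ v₂ r hy).trans_eq hyc
    · right
      filter_upwards [mem_nhdsWithin_of_mem_nhds hev', self_mem_nhdsWithin] with p hp hpS
      obtain ⟨y, v₁, v₂, r, hy, hyc⟩ := hp p.1 hpS.1 (hpS.2.trans hcon)
      simp only [hbase]
      exact hyc.symm.trans_le (hmax y v₁ v₂ r hy)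
  obtain ⟨Λ, c, q, hne, hq⟩ := ContinuousMap.exists_costate_of_isLocalExtrOn
    hP.contDiff_dilatedField (P.x₀, P.t₀, 0, 0, 0) (crossingEmbedding n)
    hP.contDiff_dilatedConstraint hP.contDiff_dilatedCost (x τ, τ) γ hstate hloc
  exact ⟨γ, Λ, c, q, hne, hγ, hq⟩

end SwitchedProblem

/-! ### Gradients of the Hamiltonian and change of time for dual paths -/

section Hamiltonian

variable {n k : ℕ}

/-- The Riesz representation, as a continuous linear map. -/
noncomputable def rieszCLM (n : ℕ) :
    (EuclideanSpace ℝ (Fin n) →L[ℝ] ℝ) →L[ℝ] EuclideanSpace ℝ (Fin n) :=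
  LinearMap.mkContinuous
    { toFun := (InnerProductSpace.toDual ℝ (EuclideanSpace ℝ (Fin n))).symm
      map_add' := map_add _
      map_smul' := fun c ℓ => by simp } 1 fun ℓ => by simp

theorem inner_rieszCLM (ℓ : EuclideanSpace ℝ (Fin n) →L[ℝ] ℝ) (v : EuclideanSpace ℝ (Fin n)) :
    inner ℝ (rieszCLM n ℓ) v = ℓ v :=
  InnerProductSpace.toDual_symm_apply

variable {f : EuclideanSpace ℝ (Fin n) → EuclideanSpace ℝ (Fin k) → ℝ → EuclideanSpace ℝ (Fin n)}
  {L : EuclideanSpace ℝ (Fin n) → EuclideanSpace ℝ (Fin k) → ℝ → ℝ}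

/-- The joint derivatives in state, control and time are the form in which the derivative of the
dilated field presents the same terms. -/
theorem inner_gradient_hamiltonian_state
    (hf : ContDiff ℝ 1 fun q : EuclideanSpace ℝ (Fin n) × EuclideanSpace ℝ (Fin k) × ℝ =>
      f q.1 q.2.1 q.2.2)
    (hL : ContDiff ℝ 1 fun q : EuclideanSpace ℝ (Fin n) × EuclideanSpace ℝ (Fin k) × ℝ =>
      L q.1 q.2.1 q.2.2)
    (y p : EuclideanSpace ℝ (Fin n)) (u : EuclideanSpace ℝ (Fin k)) (t : ℝ)
    (v : EuclideanSpace ℝ (Fin n)) :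
    inner ℝ (gradient (fun y => L y u t + inner ℝ p (f y u t)) y) v
      = fderiv ℝ (fun q : EuclideanSpace ℝ (Fin n) × EuclideanSpace ℝ (Fin k) × ℝ =>
          L q.1 q.2.1 q.2.2) (y, u, t) (v, 0, 0)
        + inner ℝ p (fderiv ℝ (fun q : EuclideanSpace ℝ (Fin n) × EuclideanSpace ℝ (Fin k) × ℝ =>
          f q.1 q.2.1 q.2.2) (y, u, t) (v, 0, 0)) := by
  have hj : HasFDerivAt (𝕜 := ℝ) (fun z : EuclideanSpace ℝ (Fin n) => (z, u, t)) _ y :=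
    HasFDerivAt.prodMk (f₁ := fun z => z) (hasFDerivAt_id y) (hasFDerivAt_const (u, t) y)
  have hL' := ((hL.differentiable one_ne_zero) (y, u, t)).hasFDerivAt
  have hf' := ((hf.differentiable one_ne_zero) (y, u, t)).hasFDerivAt
  have hLj := hL'.comp y hj
  have hfj := hf'.comp y hj
  have h : HasFDerivAt (fun y => L y u t + inner ℝ p (f y u t)) _ y :=
    hLj.add ((innerSL ℝ p).hasFDerivAt.comp y hfj)
  rw [inner_gradient_left, h.fderiv]
  rfl

theorem inner_gradient_hamiltonian_control
    (hf : ContDiff ℝ 1 fun q : EuclideanSpace ℝ (Fin n) × EuclideanSpace ℝ (Fin k) × ℝ =>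
      f q.1 q.2.1 q.2.2)
    (hL : ContDiff ℝ 1 fun q : EuclideanSpace ℝ (Fin n) × EuclideanSpace ℝ (Fin k) × ℝ =>
      L q.1 q.2.1 q.2.2)
    (y p : EuclideanSpace ℝ (Fin n)) (u : EuclideanSpace ℝ (Fin k)) (t : ℝ)
    (v : EuclideanSpace ℝ (Fin k)) :
    inner ℝ (gradient (fun u => L y u t + inner ℝ p (f y u t)) u) v
      = fderiv ℝ (fun q : EuclideanSpace ℝ (Fin n) × EuclideanSpace ℝ (Fin k) × ℝ =>
          L q.1 q.2.1 q.2.2) (y, u, t) (0, v, 0)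
        + inner ℝ p (fderiv ℝ (fun q : EuclideanSpace ℝ (Fin n) × EuclideanSpace ℝ (Fin k) × ℝ =>
          f q.1 q.2.1 q.2.2) (y, u, t) (0, v, 0)) := by
  have hj : HasFDerivAt (𝕜 := ℝ) (fun z : EuclideanSpace ℝ (Fin k) => (y, z, t)) _ u :=
    (hasFDerivAt_const y u).prodMk
      (HasFDerivAt.prodMk (f₁ := fun z => z) (hasFDerivAt_id u) (hasFDerivAt_const t u))
  have hL' := ((hL.differentiable one_ne_zero) (y, u, t)).hasFDerivAt
  have hf' := ((hf.differentiable one_ne_zero) (y, u, t)).hasFDerivAt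
  have hLj := hL'.comp u hj
  have hfj := hf'.comp u hj
  have h : HasFDerivAt (fun u => L y u t + inner ℝ p (f y u t)) _ u :=
    hLj.add ((innerSL ℝ p).hasFDerivAt.comp u hfj)
  rw [inner_gradient_left, h.fderiv]
  rfl

/-- The vector which represents one component of a dual path, in the original time scale. -/
theorem hasDerivWithinAt_rieszCLM_comp {Z : Type*} [NormedAddCommGroup Z] [NormedSpace ℝ Z]
    {a b : ℝ} (hab : a < b) {q : ℝ → Z →L[ℝ] ℝ} {q' : Z →L[ℝ] ℝ}
    (j : EuclideanSpace ℝ (Fin n) →L[ℝ] Z) {t : ℝ}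
    (hq : HasDerivWithinAt q q' (Icc 0 1) ((t - a) / (b - a))) {d : EuclideanSpace ℝ (Fin n)}
    (hd : ∀ v, q' (j v) = (b - a) * inner ℝ d v) :
    HasDerivWithinAt (fun t => rieszCLM n ((q ((t - a) / (b - a))).comp j)) d (Icc a b) t := by
  have hba := sub_pos.2 hab
  have hs : HasDerivWithinAt (fun t : ℝ => (t - a) / (b - a)) (1 / (b - a)) (Icc a b) t :=
    ((hasDerivWithinAt_id t (Icc a b)).sub_const a).div_const (b - a)
  have hmaps : MapsTo (fun t : ℝ => (t - a) / (b - a)) (Icc a b) (Icc 0 1) := fun r hr =>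
    ⟨div_nonneg (by linarith [hr.1]) hba.le, (div_le_one hba).2 (by linarith [hr.2])⟩
  have h1 := hq.scomp t hs hmaps
  have h2 := ((rieszCLM n).comp
    ((ContinuousLinearMap.compL ℝ (EuclideanSpace ℝ (Fin n)) Z ℝ).flip j)).hasFDerivAt
    |>.comp_hasDerivWithinAt t h1
  convert! h2 using 1
  refine ext_inner_right ℝ fun v => ?_
  rw [map_smul, inner_smul_left]
  change _ = _ * inner ℝ (rieszCLM n (q'.comp j)) v
  rw [inner_rieszCLM]
  change _ = _ * q' (j v)
  rw [hd]
  simp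
  field_simp

end Hamiltonian

/-! ### Derivatives of the dilated data -/

namespace SwitchedProblem

variable {n k : ℕ} {P : SwitchedProblem n k} {x : ℝ → EuclideanSpace ℝ (Fin n)}
  {u₁ u₂ : ℝ → EuclideanSpace ℝ (Fin k)} {τ : ℝ}

/-- The clock speeds enter linearly, so their variations multiply the undifferentiated dynamics and
cost. Paired with the dual path, these terms form the Hamiltonians. -/
theorem IsSmooth.fderiv_dilatedField (hP : P.IsSmooth)
    (p δ : DilatedState n × DilatedControl k) :
    fderiv ℝ P.dilatedField p δ =
      (p.2.2.1 • fderiv ℝ (fun q : EuclideanSpace ℝ (Fin n) × EuclideanSpace ℝ (Fin k) × ℝ =>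
            P.f₁ q.1 q.2.1 q.2.2) (p.1.1, p.2.1, p.1.2.1) (δ.1.1, δ.2.1, δ.1.2.1)
          + δ.2.2.1 • P.f₁ p.1.1 p.2.1 p.1.2.1,
        δ.2.2.1,
        p.2.2.2.2 • fderiv ℝ (fun q : EuclideanSpace ℝ (Fin n) × EuclideanSpace ℝ (Fin k) × ℝ =>
            P.f₂ q.1 q.2.1 q.2.2) (p.1.2.2.1, p.2.2.2.1, p.1.2.2.2.1)
            (δ.1.2.2.1, δ.2.2.2.1, δ.1.2.2.2.1)
          + δ.2.2.2.2 • P.f₂ p.1.2.2.1 p.2.2.2.1 p.1.2.2.2.1,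
        δ.2.2.2.2,
        (p.2.2.1 * fderiv ℝ (fun q : EuclideanSpace ℝ (Fin n) × EuclideanSpace ℝ (Fin k) × ℝ =>
            P.L₁ q.1 q.2.1 q.2.2) (p.1.1, p.2.1, p.1.2.1) (δ.1.1, δ.2.1, δ.1.2.1)
          + δ.2.2.1 * P.L₁ p.1.1 p.2.1 p.1.2.1)
        + (p.2.2.2.2 * fderiv ℝ
            (fun q : EuclideanSpace ℝ (Fin n) × EuclideanSpace ℝ (Fin k) × ℝ =>
            P.L₂ q.1 q.2.1 q.2.2) (p.1.2.2.1, p.2.2.2.1, p.1.2.2.2.1)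
            (δ.1.2.2.1, δ.2.2.2.1, δ.1.2.2.2.1)
          + δ.2.2.2.2 * P.L₂ p.1.2.2.1 p.2.2.2.1 p.1.2.2.2.1)) := by
  have hid : HasFDerivAt (fun z => z) (ContinuousLinearMap.id ℝ _) p := hasFDerivAt_id p
  have hw₁ := hid.snd.snd.fst
  have hw₂ := hid.snd.snd.snd.snd
  have ha₁ := hid.fst.fst.prodMk (hid.snd.fst.prodMk hid.fst.snd.fst)
  have ha₂ := hid.fst.snd.snd.fst.prodMk (hid.snd.snd.snd.fst.prodMk hid.fst.snd.snd.snd.fst)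
  have hf₁ := ((hP.f₁.differentiable one_ne_zero) (p.1.1, p.2.1, p.1.2.1)).hasFDerivAt.comp p ha₁
  have hL₁ := ((hP.L₁.differentiable one_ne_zero) (p.1.1, p.2.1, p.1.2.1)).hasFDerivAt.comp p ha₁
  have hf₂ := ((hP.f₂.differentiable one_ne_zero)
    (p.1.2.2.1, p.2.2.2.1, p.1.2.2.2.1)).hasFDerivAt.comp p ha₂
  have hL₂ := ((hP.L₂.differentiable one_ne_zero)
    (p.1.2.2.1, p.2.2.2.1, p.1.2.2.2.1)).hasFDerivAt.comp p ha₂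
  have h : HasFDerivAt P.dilatedField _ p := (hw₁.smul hf₁).prodMk (hw₁.prodMk
    ((hw₂.smul hf₂).prodMk (hw₂.prodMk ((hw₁.mul hL₁).add (hw₂.mul hL₂)))))
  rw [h.fderiv]
  simp [mul_comm]

theorem IsSmooth.fderiv_dilatedConstraint (hP : P.IsSmooth)
    (q δ : (EuclideanSpace ℝ (Fin n) × ℝ) × DilatedState n) :
    fderiv ℝ P.dilatedConstraint q δ =
      (δ.1.1 - δ.2.1, δ.1.2 - δ.2.2.1,
        inner ℝ (P.normal q.2.1 q.2.2.1) δ.2.1 + P.timeSlope q.2.1 q.2.2.1 * δ.2.2.1,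
        P.Wᗮ.orthogonalProjectionOnto δ.2.2.2.1, δ.2.2.2.2.1) := by
  have hid : HasFDerivAt (fun z => z) (ContinuousLinearMap.id ℝ _) q := hasFDerivAt_id q
  have h₁ := hid.fst.fst.sub hid.snd.fst
  have h₂ := hid.fst.snd.sub hid.snd.snd.fst
  have h₃ := hid.snd.fst.prodMk hid.snd.snd.fst
  have h₄ := hid.snd.snd.snd.fst
  have h₅ := hid.snd.snd.snd.snd.fst
  have hg := ((hP.g.differentiable one_ne_zero) (q.2.1, q.2.2.1)).hasFDerivAt.comp q h₃
  have h : HasFDerivAt P.dilatedConstraint _ q := h₁.prodMk (h₂.prodMk (hg.prodMk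
    ((P.Wᗮ.orthogonalProjectionOnto.hasFDerivAt.comp q (h₄.sub_const P.x_f)).prodMk
      (h₅.sub_const P.t_f))))
  rw [h.fderiv]
  simp [← hP.fderiv_interface]

theorem IsSmooth.fderiv_dilatedCost (hP : P.IsSmooth)
    (q δ : (EuclideanSpace ℝ (Fin n) × ℝ) × DilatedState n) :
    fderiv ℝ P.dilatedCost q δ = inner ℝ (gradient P.φ q.2.2.2.1) δ.2.2.2.1 + δ.2.2.2.2.2 := by
  have hid : HasFDerivAt (fun z => z) (ContinuousLinearMap.id ℝ _) q := hasFDerivAt_id q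
  have h₄ := hid.snd.snd.snd.fst
  have h₅ := hid.snd.snd.snd.snd.snd
  have h : HasFDerivAt P.dilatedCost _ q :=
    (((hP.φ.differentiable one_ne_zero) q.2.2.2.1).hasFDerivAt.comp q h₄).add h₅
  rw [h.fderiv, inner_gradient_left]
  rfl

end SwitchedProblem

/-! ### From dilated multipliers to a co-state -/

namespace SwitchedProblem

variable {n k : ℕ} {P : SwitchedProblem n k} {x : ℝ → EuclideanSpace ℝ (Fin n)}
  {u₁ u₂ : ℝ → EuclideanSpace ℝ (Fin k)} {τ : ℝ}

/-- The problem with all costs multiplied by a constant. -/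
def scaleCost (P : SwitchedProblem n k) (c : ℝ) : SwitchedProblem n k :=
  { P with
    L₁ := fun y u t => c * P.L₁ y u t
    L₂ := fun y u t => c * P.L₂ y u t
    φ := fun y => c * P.φ y }

theorem scaleCost_one : P.scaleCost 1 = P := by
  simp [scaleCost]

theorem scaleCost_zero : P.scaleCost 0 = P.withoutCost := by
  simp [scaleCost, withoutCost]

/-- Keeping the cost multiplier `c` general treats the normal case `c = 1` and the abnormal case `c
= 0` at once. -/
theorem inner_gradient_const_mul_add {f : EuclideanSpace ℝ (Fin n) → EuclideanSpace ℝ (Fin k) → ℝ →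
      EuclideanSpace ℝ (Fin n)} {L : EuclideanSpace ℝ (Fin n) → EuclideanSpace ℝ (Fin k) → ℝ → ℝ}
    (hf : ContDiff ℝ 1 fun q : EuclideanSpace ℝ (Fin n) × EuclideanSpace ℝ (Fin k) × ℝ =>
      f q.1 q.2.1 q.2.2)
    (hL : ContDiff ℝ 1 fun q : EuclideanSpace ℝ (Fin n) × EuclideanSpace ℝ (Fin k) × ℝ =>
      L q.1 q.2.1 q.2.2)
    (c : ℝ) (y p : EuclideanSpace ℝ (Fin n)) (u : EuclideanSpace ℝ (Fin k)) (t : ℝ) :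
    (∀ v, inner ℝ (gradient (fun y => c * L y u t + inner ℝ p (f y u t)) y) v
      = inner ℝ p (fderiv ℝ (fun q : EuclideanSpace ℝ (Fin n) × EuclideanSpace ℝ (Fin k) × ℝ =>
          f q.1 q.2.1 q.2.2) (y, u, t) (v, 0, 0))
        + c * fderiv ℝ (fun q : EuclideanSpace ℝ (Fin n) × EuclideanSpace ℝ (Fin k) × ℝ =>
          L q.1 q.2.1 q.2.2) (y, u, t) (v, 0, 0)) ∧
    ∀ v, inner ℝ (gradient (fun u => c * L y u t + inner ℝ p (f y u t)) u) v
      = inner ℝ p (fderiv ℝ (fun q : EuclideanSpace ℝ (Fin n) × EuclideanSpace ℝ (Fin k) × ℝ =>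
          f q.1 q.2.1 q.2.2) (y, u, t) (0, v, 0))
        + c * fderiv ℝ (fun q : EuclideanSpace ℝ (Fin n) × EuclideanSpace ℝ (Fin k) × ℝ =>
          L q.1 q.2.1 q.2.2) (y, u, t) (0, v, 0) := by
  have hcL : ContDiff ℝ 1 fun q : EuclideanSpace ℝ (Fin n) × EuclideanSpace ℝ (Fin k) × ℝ =>
      c * L q.1 q.2.1 q.2.2 := contDiff_const.mul hL
  have hfd := fderiv_const_mul ((hL.differentiable one_ne_zero) (y, u, t)) c
  refine ⟨fun v => ?_, fun v => ?_⟩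
  · rw [inner_gradient_hamiltonian_state (L := fun y u t => c * L y u t) hf hcL, hfd, add_comm]
    rfl
  · rw [inner_gradient_hamiltonian_control (L := fun y u t => c * L y u t) hf hcL, hfd, add_comm]
    rfl

/-- Multipliers for the problem with dilated time give a co-state for the problem with cost
multiplied by `c`; they are determined by this co-state. -/
theorem exists_isCostate_of_dilated (hP : P.IsSmooth) (hτ : τ ∈ Ioo P.t₀ P.t_f)
    {γ : C(I, DilatedState n × DilatedControl k)} {Λ : P.DilatedConstraint →L[ℝ] ℝ} {c : ℝ}
    {q : C(I, DilatedState n →L[ℝ] ℝ)}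
    (hγ : ∀ s : I, ∃ d, γ s =
        ((x (P.t₀ + (τ - P.t₀) * s), P.t₀ + (τ - P.t₀) * s,
          x (τ + (P.t_f - τ) * s), τ + (P.t_f - τ) * s, d),
          u₁ (P.t₀ + (τ - P.t₀) * s), τ - P.t₀, u₂ (τ + (P.t_f - τ) * s), P.t_f - τ))
    (hq : ∀ t ∈ Icc (0 : ℝ) 1, HasDerivWithinAt q.lineExtend
        (-((q.lineExtend t).comp ((fderiv ℝ P.dilatedField (γ.lineExtend t)).comp
          (ContinuousLinearMap.inl ℝ _ _)))) (Icc 0 1) t)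
    (hq₁ : ∀ δ, q 1 δ = Λ (fderiv ℝ P.dilatedConstraint ((x τ, τ), (γ 1).1) (0, δ))
        + c * fderiv ℝ P.dilatedCost ((x τ, τ), (γ 1).1) (0, δ))
    (hq₀ : ∀ δ, q 0 (crossingEmbedding n δ)
        = -(Λ (fderiv ℝ P.dilatedConstraint ((x τ, τ), (γ 1).1) (δ, 0))
          + c * fderiv ℝ P.dilatedCost ((x τ, τ), (γ 1).1) (δ, 0)))
    (hstat : ∀ s δ, q s (fderiv ℝ P.dilatedField (γ s) (0, δ)) = 0) :
    ∃ p₁ p₂, (P.scaleCost c).IsCostate x u₁ u₂ τ p₁ p₂ (Λ (0, 0, 1, 0, 0)) ∧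
      (c = 0 → p₁ τ = 0 → p₂ τ = 0 → p₂ P.t_f = 0 → Λ (0, 0, 1, 0, 0) = 0 → Λ = 0) := by
  have hτ₁ := sub_pos.2 hτ.1
  have hτ₂ := sub_pos.2 hτ.2
  obtain ⟨d₁, hd₁⟩ := hγ 1
  simp only [Set.Icc.coe_one, mul_one, add_sub_cancel] at hd₁
  set j₁ : EuclideanSpace ℝ (Fin n) →L[ℝ] DilatedState n := ContinuousLinearMap.inl ℝ _ _
  set j₂ : EuclideanSpace ℝ (Fin n) →L[ℝ] DilatedState n :=
    (ContinuousLinearMap.inr ℝ _ _).comp ((ContinuousLinearMap.inr ℝ _ _).comp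
      (ContinuousLinearMap.inl ℝ _ _))
  have hj₁' : ∀ v, j₁ v = (v, 0, 0, 0, 0) := fun v => rfl
  have hj₂' : ∀ v, j₂ v = (0, 0, v, 0, 0) := fun v => rfl
  have hE : ∀ A : EuclideanSpace ℝ (Fin n) × EuclideanSpace ℝ (Fin k) × ℝ →L[ℝ]
      EuclideanSpace ℝ (Fin n), A (0, 0, 0) = 0 := fun A => A.map_zero
  have hR : ∀ A : EuclideanSpace ℝ (Fin n) × EuclideanSpace ℝ (Fin k) × ℝ →L[ℝ] ℝ,
      A (0, 0, 0) = 0 := fun A => A.map_zero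
  have hZ : ∀ A : DilatedState n →L[ℝ] ℝ, A (0, 0, 0, 0, 0) = 0 := fun A => A.map_zero
  have hΛ₀ : Λ (0, 0, 0, 0, 0) = 0 := Λ.map_zero
  set Q₁ : I → EuclideanSpace ℝ (Fin n) := fun s => rieszCLM n ((q s).comp j₁) with hQ₁
  set Q₂ : I → EuclideanSpace ℝ (Fin n) := fun s => rieszCLM n ((q s).comp j₂) with hQ₂
  have hQ₁i : ∀ s v, inner ℝ (Q₁ s) v = q s (v, 0, 0, 0, 0) := fun s v => inner_rieszCLM _ _
  have hQ₂i : ∀ s v, inner ℝ (Q₂ s) v = q s (0, 0, v, 0, 0) := fun s v => inner_rieszCLM _ _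
  have hq₁' : ∀ y₁ r₁ y₂ r₂ d, q 1 (y₁, r₁, y₂, r₂, d)
      = Λ (-y₁, -r₁, inner ℝ (P.normal (x τ) τ) y₁ + P.timeSlope (x τ) τ * r₁,
          P.Wᗮ.orthogonalProjectionOnto y₂, r₂)
        + c * (inner ℝ (gradient P.φ (x P.t_f)) y₂ + d) := fun y₁ r₁ y₂ r₂ d => by
    rw [hq₁, hP.fderiv_dilatedConstraint, hP.fderiv_dilatedCost, hd₁]
    simp
  have hq₀' : ∀ y r, q 0 (0, 0, y, r, 0) = -Λ (y, r, 0, 0, 0) := fun y r => by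
    have := hq₀ (y, r)
    rw [hP.fderiv_dilatedConstraint, hP.fderiv_dilatedCost, crossingEmbedding_apply] at this
    simpa using this
  -- The dynamics do not depend on the accumulated cost, so this component of `q` is constant and
  -- equals its terminal value.
  have hκ : ∀ s, q s (0, 0, 0, 0, 1) = c := by
    have hd : ∀ t ∈ Icc (0 : ℝ) 1, HasDerivWithinAt
        (fun r => q.lineExtend r (0, 0, 0, 0, 1)) ((0 : C(I, ℝ)).lineExtend t) (Icc 0 1) t := by
      intro t ht
      have h1 := (hq t ht).clm_apply
        (hasDerivWithinAt_const t (Icc (0 : ℝ) 1) ((0, 0, 0, 0, 1) : DilatedState n))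
      convert! h1 using 1
      simp [hP.fderiv_dilatedField, ContinuousMap.lineExtend, Set.IccExtend, hE, hR, hZ]
    have h2 : ∀ s, q s (0, 0, 0, 0, 1) = q 0 (0, 0, 0, 0, 1) := fun s => by
      have := ContinuousMap.eq_add_volterra_of_hasDerivWithinAt hd s
      rwa [map_zero, ContinuousMap.zero_apply, add_zero, ContinuousMap.lineExtend_coe,
        ContinuousMap.lineExtend_zero] at this
    have h3 := hq₁' 0 0 0 0 1
    intro s
    rw [h2 s, ← h2 1, h3]
    simp [hΛ₀]
  have hsplit : ∀ s y₁ r₁ y₂ r₂ d, q s (y₁, r₁, y₂, r₂, d) = inner ℝ (Q₁ s) y₁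
      + r₁ * q s (0, 1, 0, 0, 0) + inner ℝ (Q₂ s) y₂ + r₂ * q s (0, 0, 0, 1, 0) + d * c := by
    intro s y₁ r₁ y₂ r₂ d
    rw [hQ₁i, hQ₂i, ← hκ s, ← smul_eq_mul, ← smul_eq_mul, ← smul_eq_mul, ← map_smul, ← map_smul,
      ← map_smul, ← map_add, ← map_add, ← map_add, ← map_add]
    simp
  -- Stationarity in the clock speed: the clock component of `q` is minus the Hamiltonian.
  have hham₁ : ∀ s : I, c * P.L₁ (x (P.t₀ + (τ - P.t₀) * s)) (u₁ (P.t₀ + (τ - P.t₀) * s))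
        (P.t₀ + (τ - P.t₀) * s)
      + inner ℝ (Q₁ s) (P.f₁ (x (P.t₀ + (τ - P.t₀) * s)) (u₁ (P.t₀ + (τ - P.t₀) * s))
        (P.t₀ + (τ - P.t₀) * s)) + q s (0, 1, 0, 0, 0) = 0 := fun s => by
    obtain ⟨d, hd⟩ := hγ s
    have h1 := hstat s (0, 1, 0, 0)
    rw [hP.fderiv_dilatedField, hd, hsplit] at h1
    simp [hE, hR] at h1
    linarith
  have hham₂ : ∀ s : I, c * P.L₂ (x (τ + (P.t_f - τ) * s)) (u₂ (τ + (P.t_f - τ) * s))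
        (τ + (P.t_f - τ) * s)
      + inner ℝ (Q₂ s) (P.f₂ (x (τ + (P.t_f - τ) * s)) (u₂ (τ + (P.t_f - τ) * s))
        (τ + (P.t_f - τ) * s)) + q s (0, 0, 0, 1, 0) = 0 := fun s => by
    obtain ⟨d, hd⟩ := hγ s
    have h1 := hstat s (0, 0, 0, 1)
    rw [hP.fderiv_dilatedField, hd, hsplit] at h1
    simp [hE, hR] at h1
    linarith
  set p₁ : ℝ → EuclideanSpace ℝ (Fin n) := fun t =>
    rieszCLM n ((q.lineExtend ((t - P.t₀) / (τ - P.t₀))).comp j₁) with hp₁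
  set p₂ : ℝ → EuclideanSpace ℝ (Fin n) := fun t =>
    rieszCLM n ((q.lineExtend ((t - τ) / (P.t_f - τ))).comp j₂) with hp₂
  have hs₁ : ∀ t ∈ Icc P.t₀ τ, ∃ s : I, (t - P.t₀) / (τ - P.t₀) = s ∧
      P.t₀ + (τ - P.t₀) * s = t ∧ p₁ t = Q₁ s := fun t ht => by
    have hmem : (t - P.t₀) / (τ - P.t₀) ∈ Icc (0 : ℝ) 1 :=
      ⟨div_nonneg (by linarith [ht.1]) hτ₁.le, (div_le_one hτ₁).2 (by linarith [ht.2])⟩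
    refine ⟨⟨_, hmem⟩, rfl, ?_, ?_⟩
    · rw [mul_div_cancel₀ _ hτ₁.ne', add_sub_cancel]
    · simp only [hp₁, hQ₁, ContinuousMap.lineExtend_of_mem q hmem]
  have hs₂ : ∀ t ∈ Icc τ P.t_f, ∃ s : I, (t - τ) / (P.t_f - τ) = s ∧
      τ + (P.t_f - τ) * s = t ∧ p₂ t = Q₂ s := fun t ht => by
    have hmem : (t - τ) / (P.t_f - τ) ∈ Icc (0 : ℝ) 1 :=
      ⟨div_nonneg (by linarith [ht.1]) hτ₂.le, (div_le_one hτ₂).2 (by linarith [ht.2])⟩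
    refine ⟨⟨_, hmem⟩, rfl, ?_, ?_⟩
    · rw [mul_div_cancel₀ _ hτ₂.ne', add_sub_cancel]
    · simp only [hp₂, hQ₂, ContinuousMap.lineExtend_of_mem q hmem]
  have e₁ : p₁ τ = Q₁ 1 := by
    simp only [hp₁, hQ₁, div_self hτ₁.ne', ContinuousMap.lineExtend_one]
  have e₂ : p₂ τ = Q₂ 0 := by
    simp only [hp₂, hQ₂, sub_self, zero_div, ContinuousMap.lineExtend_zero]
  have e₃ : p₂ P.t_f = Q₂ 1 := by
    simp only [hp₂, hQ₂, div_self hτ₂.ne', ContinuousMap.lineExtend_one]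
  have hΛ₃ : ∀ r : ℝ, Λ (0, 0, r, 0, 0) = Λ (0, 0, 1, 0, 0) * r := fun r => by
    rw [mul_comm, ← smul_eq_mul, ← map_smul]
    simp
  -- The matching multiplier occurs both at the end of phase 1 and, through `θ`, at the start of
  -- phase 2. Eliminating it leaves only the contribution of `g`; the clocks are treated likewise.
  have hjump₁ : ∀ v, inner ℝ (Q₁ 1) v
      = inner ℝ (Q₂ 0) v + Λ (0, 0, 1, 0, 0) * inner ℝ (P.normal (x τ) τ) v := fun v => by
    rw [hQ₁i, hQ₂i, hq₁', hq₀', ← hΛ₃, ← map_neg, ← map_add]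
    simp
  have hjump₂ : q 1 (0, 1, 0, 0, 0)
      = q 0 (0, 0, 0, 1, 0) + Λ (0, 0, 1, 0, 0) * P.timeSlope (x τ) τ := by
    rw [hq₁', hq₀', ← hΛ₃, ← map_neg, ← map_add]
    simp
  have hend₁ := hham₁ 1
  have hend₂ := hham₂ 0
  simp only [Set.Icc.coe_one, Set.Icc.coe_zero, mul_one, mul_zero, add_zero, add_sub_cancel]
    at hend₁ hend₂
  refine ⟨p₁, p₂, ⟨fun t ht => ?_, fun t ht => ?_, fun t ht => ?_, fun t ht => ?_, ?_, ?_, ?_⟩, ?_⟩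
  · obtain ⟨s, hs, hts, hpt⟩ := hs₁ t ht
    obtain ⟨d, hd⟩ := hγ s
    rw [hts] at hd
    refine hasDerivWithinAt_rieszCLM_comp hτ.1 j₁ (hs ▸ hq s s.2) fun v => ?_
    have h1 : inner ℝ (gradient (fun y => (P.scaleCost c).H₁ y (p₁ t) (u₁ t) t) (x t)) v = _ :=
      (inner_gradient_const_mul_add hP.f₁ hP.L₁ c (x t) (p₁ t) (u₁ t) t).1 v
    rw [inner_neg_left, h1, hs, ContinuousMap.lineExtend_coe, ContinuousMap.lineExtend_coe]
    change -(q s (fderiv ℝ P.dilatedField (γ s) (j₁ v, 0))) = _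
    rw [hP.fderiv_dilatedField, hd, hsplit, hpt, hj₁']
    simp [inner_smul_right, hE, hR]
    ring
  · obtain ⟨s, hs, hts, hpt⟩ := hs₂ t ht
    obtain ⟨d, hd⟩ := hγ s
    rw [hts] at hd
    refine hasDerivWithinAt_rieszCLM_comp hτ.2 j₂ (hs ▸ hq s s.2) fun v => ?_
    have h1 : inner ℝ (gradient (fun y => (P.scaleCost c).H₂ y (p₂ t) (u₂ t) t) (x t)) v = _ :=
      (inner_gradient_const_mul_add hP.f₂ hP.L₂ c (x t) (p₂ t) (u₂ t) t).1 v
    rw [inner_neg_left, h1, hs, ContinuousMap.lineExtend_coe, ContinuousMap.lineExtend_coe]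
    change -(q s (fderiv ℝ P.dilatedField (γ s) (j₂ v, 0))) = _
    rw [hP.fderiv_dilatedField, hd, hsplit, hpt, hj₂']
    simp [inner_smul_right, hE, hR]
    ring
  · obtain ⟨s, hs, hts, hpt⟩ := hs₁ t ht
    obtain ⟨d, hd⟩ := hγ s
    rw [hts] at hd
    refine ext_inner_right ℝ fun v => ?_
    have h1 : inner ℝ (gradient (fun v => (P.scaleCost c).H₁ (x t) (p₁ t) v t) (u₁ t)) v = _ :=
      (inner_gradient_const_mul_add hP.f₁ hP.L₁ c (x t) (p₁ t) (u₁ t) t).2 v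
    have h2 := hstat s (v, 0, 0, 0)
    rw [hP.fderiv_dilatedField, hd, hsplit] at h2
    simp only [Prod.fst_zero, Prod.snd_zero] at h2
    rw [h1, inner_zero_left, hpt]
    -- Dilated stationarity carries the clock speed `τ - t₀` as a nonzero factor.
    refine mul_left_cancel₀ hτ₁.ne' ((Eq.trans ?_ h2).trans (mul_zero _).symm)
    simp [inner_smul_right, hE, hR]
    ring
  · obtain ⟨s, hs, hts, hpt⟩ := hs₂ t ht
    obtain ⟨d, hd⟩ := hγ s
    rw [hts] at hd
    refine ext_inner_right ℝ fun v => ?_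
    have h1 : inner ℝ (gradient (fun v => (P.scaleCost c).H₂ (x t) (p₂ t) v t) (u₂ t)) v = _ :=
      (inner_gradient_const_mul_add hP.f₂ hP.L₂ c (x t) (p₂ t) (u₂ t) t).2 v
    have h2 := hstat s (0, 0, v, 0)
    rw [hP.fderiv_dilatedField, hd, hsplit] at h2
    simp only [Prod.fst_zero, Prod.snd_zero] at h2
    rw [h1, inner_zero_left, hpt]
    refine mul_left_cancel₀ hτ₂.ne' ((Eq.trans ?_ h2).trans (mul_zero _).symm)
    simp [inner_smul_right, hE, hR]
    ring
  · change p₂ P.t_f - gradient (fun y => c * P.φ y) (x P.t_f) ∈ P.Wᗮ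
    rw [Submodule.mem_orthogonal']
    intro v hv
    have hφ := (hP.φ.differentiable one_ne_zero) (x P.t_f)
    rw [inner_sub_left, e₃, hQ₂i, hq₁', inner_gradient_left, inner_gradient_left,
      fderiv_const_mul hφ, orthogonalProjectionOnto_orthogonal_eq_zero_iff.2 hv]
    simp [hΛ₀]
  · change p₂ τ - p₁ τ + Λ (0, 0, 1, 0, 0) • P.normal (x τ) τ = 0
    rw [e₁, e₂]
    refine ext_inner_right ℝ fun v => ?_
    rw [inner_add_left, inner_sub_left, inner_smul_left, hjump₁, inner_zero_left]
    simp
  · change c * P.L₂ (x τ) (u₂ τ) τ + inner ℝ (p₂ τ) (P.f₂ (x τ) (u₂ τ) τ)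
      - (c * P.L₁ (x τ) (u₁ τ) τ + inner ℝ (p₁ τ) (P.f₁ (x τ) (u₁ τ) τ))
      = Λ (0, 0, 1, 0, 0) * P.timeSlope (x τ) τ
    rw [e₁, e₂]
    linarith
  -- For `c = 0`, the components of `Λ` are recovered from the data at `τ` and `t_f`: the matching
  -- parts from `q 0`, the terminal parts from `q 1`. Vanishing `λ₂` at these times also kills the
  -- clock components, through the Hamiltonian identities.
  · intro hc h1 h2 h3 hν
    rw [e₁] at h1
    rw [e₂] at h2
    rw [e₃] at h3
    have hfin := hham₂ 1
    rw [hc, h3, inner_zero_left] at hfin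
    rw [hc, h2, inner_zero_left] at hend₂
    have a₁ : ∀ v, Λ (v, 0, 0, 0, 0) = 0 := fun v => by
      rw [← neg_eq_zero, ← hq₀', ← hQ₂i, h2, inner_zero_left]
    have a₂ : Λ (0, 1, 0, 0, 0) = 0 := by
      rw [← neg_eq_zero, ← hq₀']
      linarith
    have a₄ : ∀ w : P.Wᗮ, Λ (0, 0, 0, w, 0) = 0 := fun w => by
      have h4 := hq₁' 0 0 (w : EuclideanSpace ℝ (Fin n)) 0 0
      rw [← hQ₂i, h3, inner_zero_left, hc] at h4
      simpa using h4.symm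
    have a₅ : Λ (0, 0, 0, 0, 1) = 0 := by
      have h4 := hq₁' 0 0 0 1 0
      rw [hc] at h4
      simp at h4
      rw [← h4]
      linarith
    refine ContinuousLinearMap.ext fun ⟨v, r, b, w, d⟩ => ?_
    have hdec : ((v, r, b, w, d) : P.DilatedConstraint) = (v, 0, 0, 0, 0) + r • (0, 1, 0, 0, 0)
        + b • (0, 0, 1, 0, 0) + (0, 0, 0, w, 0) + d • (0, 0, 0, 0, 1) := by simp
    rw [hdec, map_add, map_add, map_add, map_add, map_smul, map_smul, map_smul, a₁, a₂, hν, a₄, a₅]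
    simp

end SwitchedProblem

/-! ### Normality, existence of a co-state and the jump law -/

namespace SwitchedProblem

variable {n k : ℕ} {P : SwitchedProblem n k} {x : ℝ → EuclideanSpace ℝ (Fin n)}
  {u₁ u₂ : ℝ → EuclideanSpace ℝ (Fin k)} {τ : ℝ}

/-- A solution of the adjoint equation without stage cost vanishes if its terminal value does. -/
theorem eq_zero_of_adjoint_of_terminal {f : EuclideanSpace ℝ (Fin n) →
      EuclideanSpace ℝ (Fin k) → ℝ → EuclideanSpace ℝ (Fin n)}
    (hf : ContDiff ℝ 1 fun q : EuclideanSpace ℝ (Fin n) × EuclideanSpace ℝ (Fin k) × ℝ =>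
      f q.1 q.2.1 q.2.2)
    {u : ℝ → EuclideanSpace ℝ (Fin k)} {p : ℝ → EuclideanSpace ℝ (Fin n)} {a b : ℝ}
    (hx : ContinuousOn x (Icc a b)) (hu : ContinuousOn u (Icc a b))
    (hp : ∀ t ∈ Icc a b, HasDerivWithinAt p
      (-gradient (fun y => 0 + inner ℝ (p t) (f y (u t) t)) (x t)) (Icc a b) t)
    (hb : p b = 0) : ∀ t ∈ Icc a b, p t = 0 := by
  set A : ℝ → EuclideanSpace ℝ (Fin n) →L[ℝ] EuclideanSpace ℝ (Fin n) := fun t =>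
    (fderiv ℝ (fun q : EuclideanSpace ℝ (Fin n) × EuclideanSpace ℝ (Fin k) × ℝ =>
      f q.1 q.2.1 q.2.2) (x t, u t, t)).comp (ContinuousLinearMap.inl ℝ _ _) with hA
  have hAc : ContinuousOn A (Icc a b) :=
    (((hf.continuous_fderiv one_ne_zero).comp_continuousOn
      (hx.prodMk (hu.prodMk continuousOn_id))).clm_comp continuousOn_const)
  obtain ⟨K, hK⟩ := isCompact_Icc.exists_bound_of_continuousOn hAc
  have hgrad : ∀ t, gradient (fun y => 0 + inner ℝ (p t) (f y (u t) t)) (x t)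
      = ContinuousLinearMap.adjoint (A t) (p t) := fun t => by
    refine ext_inner_right ℝ fun v => ?_
    rw [ContinuousLinearMap.adjoint_inner_left]
    have h1 := inner_gradient_hamiltonian_state (L := fun _ _ _ => 0) hf contDiff_const
      (x t) (p t) (u t) t v
    rw [h1]
    simp [hA]
    rfl
  have hmem : ∀ t ∈ Ioc a b, Icc a b ∈ 𝓝[≤] t := fun t ht =>
    mem_of_superset (Icc_mem_nhdsLE ht.1) (Icc_subset_Icc_right ht.2)
  -- The equation is linear with coefficient bounded by `K`, so uniqueness backward from `b`
  -- compares `p` with the zero solution.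
  refine ODE_solution_unique_of_mem_Icc_left (K := K.toNNReal) (s := fun _ => univ)
    (g := fun _ => 0) (v := fun t y => -ContinuousLinearMap.adjoint (A t) y) (fun t ht => ?_)
    (fun t ht => (hp t ht).continuousWithinAt) (fun t ht => ?_) (fun _ _ => mem_univ _)
    continuousOn_const (fun t ht => ?_) (fun _ _ => mem_univ _) hb
  · refine ((-ContinuousLinearMap.adjoint (A t)).lipschitz.weaken ?_).lipschitzOnWith
    rw [← NNReal.coe_le_coe, coe_nnnorm, norm_neg, LinearIsometryEquiv.norm_map]
    exact (hK t ⟨ht.1.le, ht.2⟩).trans (Real.le_coe_toNNReal K)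
  · have h1 := hp t ⟨ht.1.le, ht.2⟩
    rw [hgrad] at h1
    exact h1.mono_of_mem_nhdsWithin (hmem t ht)
  · simpa using hasDerivWithinAt_const t (Iic t) (0 : EuclideanSpace ℝ (Fin n))

/-- At a transversal crossing, the multiplier of an abnormal co-state vanishes together with the
co-state after the crossing. -/
theorem IsCostate.multiplier_eq_zero (htrans : P.IsTransversal x u₁ u₂ τ)
    {p₁ p₂ : ℝ → EuclideanSpace ℝ (Fin n)} {ν : ℝ}
    (h : P.withoutCost.IsCostate x u₁ u₂ τ p₁ p₂ ν) (h₂ : p₂ τ = 0) : ν = 0 := by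
  have hj : p₂ τ - p₁ τ + ν • P.normal (x τ) τ = 0 := h.jump
  have hh : 0 + inner ℝ (p₂ τ) (P.f₂ (x τ) (u₂ τ) τ)
      - (0 + inner ℝ (p₁ τ) (P.f₁ (x τ) (u₁ τ) τ)) = ν * P.timeSlope (x τ) τ := h.hamiltonian
  have h₁ : p₁ τ = ν • P.normal (x τ) τ := by
    rw [h₂, zero_sub, neg_add_eq_zero] at hj
    exact hj
  rw [h₂, h₁, inner_zero_left, real_inner_smul_left] at hh
  -- With `λ₂(τ) = 0`, the two crossing conditions combine to `ν (mᵀf₁ + μ) = 0`.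
  refine (mul_eq_zero.1 ?_).resolve_right htrans.1
  linarith

/-- With free terminal state, every process with a transversal crossing is normal. -/
theorem IsAdmissible.isNormal_of_eq_top (hP : P.IsSmooth) (h : P.IsAdmissible x u₁ u₂ τ)
    (htrans : P.IsTransversal x u₁ u₂ τ) (hW : P.W = ⊤) : P.IsNormal x u₁ u₂ τ := by
  intro p₁ p₂ ν hc
  have hend : p₂ P.t_f = 0 := by
    have h1 : p₂ P.t_f - gradient (fun _ => (0 : ℝ)) (x P.t_f) ∈ P.Wᗮ := hc.terminal
    have h2 : gradient (fun _ => (0 : ℝ)) (x P.t_f) = 0 := by simp [gradient]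
    rw [hW, Submodule.top_orthogonal_eq_bot, Submodule.mem_bot, h2, sub_zero] at h1
    exact h1
  -- Zero propagates backward: through phase 2, across the crossing because `ν = 0`, then through
  -- phase 1.
  have h₂ := eq_zero_of_adjoint_of_terminal hP.f₂ h.continuousOn_state₂ h.continuousOn₂
    hc.adjoint₂ hend
  have h₂τ := h₂ τ ⟨le_rfl, h.mem_Ioo.2.le⟩
  have hν := hc.multiplier_eq_zero htrans h₂τ
  have h₁τ : p₁ τ = 0 := by
    simpa [h₂τ, hν] using hc.jump
  exact ⟨eq_zero_of_adjoint_of_terminal hP.f₁ h.continuousOn_state₁ h.continuousOn₁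
    hc.adjoint₁ h₁τ, h₂⟩

/-- A normal optimal process with a transversal crossing has a co-state. -/
theorem IsOptimal.exists_isCostate (hP : P.IsSmooth) (hopt : P.IsOptimal x u₁ u₂ τ)
    (htrans : P.IsTransversal x u₁ u₂ τ) (hnormal : P.IsNormal x u₁ u₂ τ) :
    ∃ p₁ p₂ ν, P.IsCostate x u₁ u₂ τ p₁ p₂ ν := by
  obtain ⟨γ, Λ, c, q, hc, hγ, hq, hq₁, hq₀, hstat⟩ := hopt.exists_dilated_costate hP htrans
  have hτ := hopt.1.mem_Ioo
  obtain ⟨p₁, p₂, hcs, hΛ⟩ := exists_isCostate_of_dilated hP hτ hγ hq hq₁ hq₀ hstat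
  rcases hc with rfl | ⟨rfl, hΛ₀⟩
  · rw [scaleCost_one] at hcs
    exact ⟨p₁, p₂, _, hcs⟩
  · rw [scaleCost_zero] at hcs
    obtain ⟨h₁, h₂⟩ := hnormal p₁ p₂ _ hcs
    have h₂τ := h₂ τ ⟨le_rfl, hτ.2.le⟩
    exact absurd (hΛ rfl (h₁ τ ⟨hτ.1.le, le_rfl⟩) h₂τ (h₂ P.t_f ⟨hτ.2.le, le_rfl⟩)
      (hcs.multiplier_eq_zero htrans h₂τ)) hΛ₀

/-- The conditions at the crossing determine the jump of a co-state. -/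
theorem IsCostate.jumpLaw {p₁ p₂ : ℝ → EuclideanSpace ℝ (Fin n)} {ν : ℝ}
    (h : P.IsCostate x u₁ u₂ τ p₁ p₂ ν)
    (hpos : 0 < (1 / 2 : ℝ) *
        ((inner ℝ (P.normal (x τ) τ) (P.f₁ (x τ) (u₁ τ) τ) + P.timeSlope (x τ) τ) +
          (inner ℝ (P.normal (x τ) τ) (P.f₂ (x τ) (u₂ τ) τ) + P.timeSlope (x τ) τ))) :
    P.JumpLaw x u₁ u₂ τ p₁ p₂ := by
  have hj : p₂ τ = p₁ τ - ν • P.normal (x τ) τ := by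
    have := h.jump
    exact eq_sub_of_add_eq (sub_eq_zero.1 ((sub_add_eq_add_sub _ _ _).symm.trans this))
  have hh : P.L₂ (x τ) (u₂ τ) τ + inner ℝ (p₂ τ) (P.f₂ (x τ) (u₂ τ) τ)
      - (P.L₁ (x τ) (u₁ τ) τ + inner ℝ (p₁ τ) (P.f₁ (x τ) (u₁ τ) τ))
      = ν * P.timeSlope (x τ) τ := h.hamiltonian
  dsimp only [JumpLaw]
  -- The quotient in the jump law is the multiplier itself; after `λ₂` is eliminated, this is the
  -- Hamiltonian condition.
  rw [show _ / _ = ν from ?_, hj, neg_smul]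
  · abel
  rw [div_eq_iff hpos.ne', hj]
  rw [hj, inner_sub_left, real_inner_smul_left] at hh
  rw [real_inner_smul_left, inner_add_left, inner_sub_left, real_inner_smul_left, inner_sub_right,
    inner_sub_right]
  linarith

end SwitchedProblem

theorem mainTheorem3 {n k : ℕ} (P : SwitchedProblem n k) (hP : P.IsSmooth)
    (x : ℝ → EuclideanSpace ℝ (Fin n)) (u₁ u₂ : ℝ → EuclideanSpace ℝ (Fin k)) (τ : ℝ)
    (hopt : P.IsOptimal x u₁ u₂ τ)
    (htrans : P.IsTransversal x u₁ u₂ τ)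
    (hnormal : P.W = ⊤ ∨ P.IsNormal x u₁ u₂ τ) :
    0 < (1 / 2 : ℝ) *
        ((inner ℝ (P.normal (x τ) τ) (P.f₁ (x τ) (u₁ τ) τ) + P.timeSlope (x τ) τ) +
          (inner ℝ (P.normal (x τ) τ) (P.f₂ (x τ) (u₂ τ) τ) + P.timeSlope (x τ) τ)) ∧
      (∃ p₁ p₂ ν, P.IsCostate x u₁ u₂ τ p₁ p₂ ν) ∧
      (∀ p₁ p₂ ν, P.IsCostate x u₁ u₂ τ p₁ p₂ ν → P.JumpLaw x u₁ u₂ τ p₁ p₂) := by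
  have hadm := hopt.1
  obtain ⟨h₁, h₂⟩ := hadm.crossing_speed_pos hP htrans
  have hpos := mul_pos (one_half_pos (α := ℝ)) (add_pos h₁ h₂)
  have hn : P.IsNormal x u₁ u₂ τ :=
    hnormal.elim (fun hW => hadm.isNormal_of_eq_top hP htrans hW) id
  exact ⟨hpos, hopt.exists_isCostate hP htrans hn, fun p₁ p₂ ν h => h.jumpLaw hpos⟩
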